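/- Let $e\in\mathbb C$ be a primitive $5$th root of unity and let $(x:y:z:w)$ be homogeneous coordinates on $\mathbb P^3=\mathbb P^3_{\mathbb C}$. Let $Q$ be the quartic surface with equation $$x^4+2x^2zw-8xyz^2+4y^3z-4yw^3+5z^2w^2+(e^3+e^2)\left(-4x^2zw-4xy^2w+12xyz^2-4y^3z+8yw^3-8z^2w^2\right)=0$$ and let $S$ be the quintic surface with equation $$\begin{aligned}&x^5+\tfrac{10}{3}x^3zw-20x^2yz^2+20xy^3z-20xyw^3+25xz^2w^2-\tfrac43y^5-\tfrac{140}{3}y^2zw^2+80yz^3w-\tfrac{136}{3}z^5+4w^5\\&+(e^3+e^2)\left(-\tfrac{20}{3}x^3zw-10x^2y^2w+30x^2yz^2-20xy^3z+40xyw^3-40xz^2w^2+70y^2zw^2-130yz^3w+\tfrac{220}{3}z^5-\tfrac{20}{3}w^5\right)=0.\end{aligned}$$ Both equations have coefficients in $\mathbb Q(e)$. Let $\mathbb Z_5$ act on $\mathbb P^3$ through the cyclic group of order $5$ generated by $(x,y,z,w)\mapsto(x,ey,e^2z,e^3w)$. Then: 1. The equations of $Q$ and $S$ (hence the surfaces $Q$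 and $S$) are invariant under this $\mathbb Z_5$-action, and $\mathbb Z_5$ acts freely on $S$. 2. $S$ has exactly $15$ singular points, and each of them is an ordinary cusp, i.e. a singularity of type $A_2$ (locally analytically isomorphic to $X^2+Y^2+Z^3=0$ at the origin). 3. $Q$ is a Kummer quartic: it is irreducible and has exactly $16$ singular points, all of which are nodes (locally analytically isomorphic to $X^2+Y^2+Z^2=0$ at the origin). 4. Exactly one node of $Q$ is fixed by the $\mathbb Z_5$-action, namely $(0:0:1:0)$, and the other $15$ nodes of $Q$ are precisely the $15$ cusps of $S$. -/

import Mathlib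

open scoped LinearAlgebra.Projectivization Topology

namespace RitoQuintic

noncomputable section

/-- The vector space of homogeneous coordinates `(x, y, z, w)`. -/
abbrev V4 : Type := Fin 4 → ℂ

/-- Complex projective 3-space. -/
abbrev P3 : Type := ℙ ℂ V4

/-! ### Surfaces in projective 3-space and their singularities -/

/-- The set of points of the surface `F = 0`, for a homogeneous polynomial `F`. -/
def surface (F : MvPolynomial (Fin 4) ℂ) : Set P3 :=
  {p | MvPolynomial.eval p.rep F = 0}

/-- The singular points of the surface `F = 0` (Jacobian criterion), for `F` homogeneous. -/
def singularLocus (F : MvPolynomial (Fin 4) ℂ) : Set P3 :=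
  {p | p ∈ surface F ∧ ∀ i, MvPolynomial.eval p.rep (MvPolynomial.pderiv i F) = 0}

/-- The analytic germ of the surface `f = 0` at the point `a` of `ℂ³` is isomorphic to the germ of
`X² + Y² + Z ^ (k + 1) = 0` at the origin: up to a holomorphic unit `h`, the function `f` takes that
form in some system of local holomorphic coordinates `φ 0, φ 1, φ 2` centred at `a`. -/
def IsGermOfTypeA (k : ℕ) (f : (Fin 3 → ℂ) → ℂ) (a : Fin 3 → ℂ) : Prop :=
  ∃ (φ : Fin 3 → (Fin 3 → ℂ) → ℂ) (h : (Fin 3 → ℂ) → ℂ),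
    (∀ i, AnalyticAt ℂ (φ i) a) ∧ (∀ i, φ i a = 0) ∧
    LinearIndependent ℂ (fun i => fderiv ℂ (φ i) a) ∧
    AnalyticAt ℂ h a ∧ h a ≠ 0 ∧
    ∀ᶠ x in 𝓝 a, f x = h x * (φ 0 x ^ 2 + φ 1 x ^ 2 + φ 2 x ^ (k + 1))

/-- The surface `F = 0` (with `F` homogeneous) has a point of type `A_k` at `p`. The germ is read
in an affine chart `x_i = 1` containing `p`; germs in different charts are isomorphic. -/
def HasTypeA (k : ℕ) (F : MvPolynomial (Fin 4) ℂ) (p : P3) : Prop :=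
  ∃ i : Fin 4, p.rep i ≠ 0 ∧
    IsGermOfTypeA k (fun u => MvPolynomial.eval (i.insertNth (1 : ℂ) u : V4) F)
      (fun j => p.rep (i.succAbove j) / p.rep i)

/-- Nodes (ordinary double points) are the singularities of type `A_1`. -/
def IsNode (F : MvPolynomial (Fin 4) ℂ) (p : P3) : Prop := HasTypeA 1 F p

/-- Ordinary cusps are the singularities of type `A_2`. -/
def IsCusp (F : MvPolynomial (Fin 4) ℂ) (p : P3) : Prop := HasTypeA 2 F p

/-- A Kummer quartic: an irreducible quartic surface whose singularities are exactly 16 nodes. -/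
def IsKummerQuartic (F : MvPolynomial (Fin 4) ℂ) : Prop :=
  F.IsHomogeneous 4 ∧ Irreducible F ∧ (singularLocus F).ncard = 16 ∧
    ∀ p ∈ singularLocus F, IsNode F p

/-! ### The action of the cyclic group of order five -/

/-- The linear automorphism `(x, y, z, w) ↦ (x, e y, e² z, e³ w)`. The group generated by it acts
on `P3` through the action of linear automorphisms on the projective space. -/
def gen (e : ℂˣ) : V4 ≃ₗ[ℂ] V4 :=
  LinearEquiv.piCongrRight fun i : Fin 4 => LinearEquiv.smulOfUnit (e ^ (i : ℕ))

/-- The polynomial `F` is invariant: `F (x, e y, e² z, e³ w) = F (x, y, z, w)`. -/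
def IsInvariant (e : ℂˣ) (F : MvPolynomial (Fin 4) ℂ) : Prop :=
  MvPolynomial.aeval (fun i : Fin 4 => MvPolynomial.C ((e : ℂ) ^ (i : ℕ)) * MvPolynomial.X i) F = F

/-- The point `(0 : 0 : 1 : 0)`. -/
def fixedPoint : P3 := Projectivization.mk ℂ (![0, 0, 1, 0] : V4) (by simp)

/-! ### The explicit equations -/

/-- The coordinate function `x`. -/
abbrev x : MvPolynomial (Fin 4) ℂ := MvPolynomial.X 0

/-- The coordinate function `y`. -/
abbrev y : MvPolynomial (Fin 4) ℂ := MvPolynomial.X 1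

/-- The coordinate function `z`. -/
abbrev z : MvPolynomial (Fin 4) ℂ := MvPolynomial.X 2

/-- The coordinate function `w`. -/
abbrev w : MvPolynomial (Fin 4) ℂ := MvPolynomial.X 3

/-- The equation of the quartic `Q`. -/
def quartic (e : ℂ) : MvPolynomial (Fin 4) ℂ :=
  x ^ 4 + 2 * x ^ 2 * z * w - 8 * x * y * z ^ 2 + 4 * y ^ 3 * z - 4 * y * w ^ 3
    + 5 * z ^ 2 * w ^ 2
  + MvPolynomial.C (e ^ 3 + e ^ 2) *
    (-4 * x ^ 2 * z * w - 4 * x * y ^ 2 * w + 12 * x * y * z ^ 2 - 4 * y ^ 3 * z + 8 * y * w ^ 3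
      - 8 * z ^ 2 * w ^ 2)

/-- The equation of the quintic `S`. -/
def quintic (e : ℂ) : MvPolynomial (Fin 4) ℂ :=
  x ^ 5 + MvPolynomial.C (10 / 3) * x ^ 3 * z * w - 20 * x ^ 2 * y * z ^ 2 + 20 * x * y ^ 3 * z
    - 20 * x * y * w ^ 3 + 25 * x * z ^ 2 * w ^ 2 - MvPolynomial.C (4 / 3) * y ^ 5
    - MvPolynomial.C (140 / 3) * y ^ 2 * z * w ^ 2 + 80 * y * z ^ 3 * w
    - MvPolynomial.C (136 / 3) * z ^ 5 + 4 * w ^ 5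
  + MvPolynomial.C (e ^ 3 + e ^ 2) *
    (-MvPolynomial.C (20 / 3) * x ^ 3 * z * w - 10 * x ^ 2 * y ^ 2 * w + 30 * x ^ 2 * y * z ^ 2
      - 20 * x * y ^ 3 * z + 40 * x * y * w ^ 3 - 40 * x * z ^ 2 * w ^ 2 + 70 * y ^ 2 * z * w ^ 2
      - 130 * y * z ^ 3 * w + MvPolynomial.C (220 / 3) * z ^ 5
      - MvPolynomial.C (20 / 3) * w ^ 5)

end

end RitoQuintic

/-!
Put `φ = 1 + e² + e³`. The relation `1 + e + e² + e³ + e⁴ = 0` gives `φ² = φ + 1`, and the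
coefficients of both equations lie in `ℚ(φ)`, so that all computations take place over this
quadratic field; a number `p + q φ` with `p`, `q` rational is non-zero as soon as its norm is
(`add_mul_golden_ne_zero`).

*Singular points of `Q`.* From the partial derivatives of the quartic one gets `y⁶ = x⁵ y` and two
more relations (`quartic_relation_y`, `quartic_relation_z`, `quartic_relation_w`). They leave the
point `(0 : 0 : 1 : 0)` and, in the chart `w = 1`, the points `(η³ x₀, η² y₀, η z₀)` with `η⁵ = 1`,
where `(x₀, y₀, z₀)` is one of `(1, 1, 1)`, `(φ - 2, φ - 2, -1 - φ)`, `(φ - 1, 0, φ)`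
(`eq_nodePoint_of_quarticD_eq_zero`). These are three orbits of five points each.

*Singular points of `S`.* The derivative of the quintic with respect to `x` is five times the
quartic, so the singular points of `S` lie on `Q`. Moreover the Jacobian ideal of the quintic
contains `x² (∂Q)²` for every partial derivative `∂Q` of the quartic (`sq_quarticDx_of_quintic` and
its companions), and `x = 0` forces `y = z = w = 0` (`y_eq_zero_of_quintic` and its companions).
Hence the singular points of `S` are singular points of `Q` with `x ≠ 0`, which excludes
`(0 : 0 : 1 : 0)`; the other fifteen are indeed singular on `S`.

*Types of the singularities.* It suffices to treat one point of each orbit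
(`IsGermOfTypeA.of_semiinvariant`). Taylor expansion writes the quartic as a quadratic form in the
local coordinates with polynomial coefficients (`quarticForm_germ`), and completing squares gives a
node if the Hessian is non-degenerate (`isGermOfTypeA_one_of_quadratic`). At a common singular
point of `S` and `Q` all second derivatives of the quintic that involve `x` vanish, so the
direction `x` lies in the kernel of its Hessian. If the remaining `2 × 2` minor and the third
derivative along `x` do not vanish, the point is of type `A₂` (`quinticForm_germ`,
`isGermOfTypeA_two_of_quadratic_add_cube`). Non-vanishing coefficients are absorbed into the
coordinates by means of analytic roots (`isGermOfTypeA_of_sum_pow`).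

*Irreducibility and freeness.* The quartic is monic in `x`, and its restriction to `z = 0`, `w = 1`
is an Eisenstein polynomial at `y` (`irreducible_section`). A non-trivial element of the group has
four distinct eigenvalues, so it fixes only the four coordinate points, none of which lies on `S`
(`smul_ne_of_mem_surface_quintic`).
-/

namespace RitoQuintic

/-! ### Normal forms of surface germs -/

/-- A non-vanishing analytic function has an analytic `n`-th root: factor out a root of the value
at the point, and use the principal branch of the logarithm for the rest. -/
theorem exists_analyticAt_pow_eq {E : Type*} [NormedAddCommGroup E] [NormedSpace ℂ E]
    {P : E → ℂ} {a : E} (hP : AnalyticAt ℂ P a) (h0 : P a ≠ 0) {n : ℕ} (hn : n ≠ 0) :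
    ∃ r : E → ℂ, AnalyticAt ℂ r a ∧ r a ≠ 0 ∧ ∀ᶠ x in 𝓝 a, r x ^ n = P x := by
  obtain ⟨c, hc⟩ := IsAlgClosed.exists_pow_nat_eq (P a) (Nat.pos_of_ne_zero hn)
  have hc0 : c ≠ 0 := by
    rintro rfl
    rw [zero_pow hn] at hc
    exact h0 hc.symm
  refine ⟨fun x => c * Complex.exp (Complex.log (P x / P a) / n), ?_, ?_, ?_⟩
  · have h1 : AnalyticAt ℂ (fun x => P x / P a) a := hP.div_const
    have h2 : AnalyticAt ℂ (fun x => Complex.log (P x / P a)) a :=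
      h1.clog (by simp [div_self h0, Complex.one_mem_slitPlane])
    exact analyticAt_const.mul (h2.div_const).cexp
  · exact mul_ne_zero hc0 (Complex.exp_ne_zero _)
  · filter_upwards [hP.continuousAt.eventually_ne h0] with x hx
    have hn' : (n : ℂ) ≠ 0 := Nat.cast_ne_zero.2 hn
    rw [mul_pow, hc, ← Complex.exp_nat_mul, mul_div_cancel₀ _ hn',
      Complex.exp_log (div_ne_zero hx h0), mul_div_cancel₀ _ h0]

theorem linearIndependent_triangular {V : Type*} [AddCommGroup V] [Module ℂ V] {u : Fin 3 → V}
    (hu : LinearIndependent ℂ u) (p q r : ℂ) :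
    LinearIndependent ℂ ![u 0 + p • u 1 + q • u 2, u 1 + r • u 2, u 2] := by
  rw [Fintype.linearIndependent_iff] at hu ⊢
  intro g hg
  have h := hu ![g 0, g 0 * p + g 1, g 0 * q + g 1 * r + g 2] (by
    rw [← hg]
    simp only [Fin.sum_univ_three, Matrix.cons_val]
    module)
  have h0 : g 0 = 0 := by simpa using h 0
  have h1 : g 1 = 0 := by simpa [h0] using h 1
  have h2 : g 2 = 0 := by simpa [h0, h1] using h 2
  intro i
  fin_cases i <;> assumption

theorem hasFDerivAt_mul_of_eq_zero {E : Type*} [NormedAddCommGroup E] [NormedSpace ℂ E]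
    {p u : E → ℂ} {a : E} (hp : AnalyticAt ℂ p a) (hu : AnalyticAt ℂ u a) (h0 : u a = 0) :
    HasFDerivAt (fun x => p x * u x) (p a • fderiv ℂ u a) a := by
  refine (hp.differentiableAt.hasFDerivAt.mul hu.differentiableAt.hasFDerivAt).congr_fderiv ?_
  ext x
  simp [h0]

/-- A germ that is a combination of `l₀²`, `l₁²`, `l₂^(k+1)` with non-vanishing analytic
coefficients is of type `A_k`, because the coefficients can be absorbed into the coordinates by
extracting roots. -/
theorem isGermOfTypeA_of_sum_pow {k : ℕ} {f : (Fin 3 → ℂ) → ℂ} {a : Fin 3 → ℂ}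
    {l P : Fin 3 → (Fin 3 → ℂ) → ℂ} (hl : ∀ i, AnalyticAt ℂ (l i) a) (hla : ∀ i, l i a = 0)
    (hli : LinearIndependent ℂ fun i => fderiv ℂ (l i) a)
    (hP : ∀ i, AnalyticAt ℂ (P i) a) (hPa : ∀ i, P i a ≠ 0)
    (hf : ∀ᶠ x in 𝓝 a, f x = P 0 x * l 0 x ^ 2 + P 1 x * l 1 x ^ 2 + P 2 x * l 2 x ^ (k + 1)) :
    IsGermOfTypeA k f a := by
  obtain ⟨r, hr⟩ : ∃ r : Fin 3 → (Fin 3 → ℂ) → ℂ, ∀ i, AnalyticAt ℂ (r i) a ∧ r i a ≠ 0 ∧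
      ∀ᶠ x in 𝓝 a, r i x ^ (![2, 2, k + 1] i) = P i x := by
    refine ⟨fun i => (exists_analyticAt_pow_eq (hP i) (hPa i) (n := ![2, 2, k + 1] i)
      (by fin_cases i <;> simp)).choose, fun i => Exists.choose_spec
        (exists_analyticAt_pow_eq (hP i) (hPa i) (n := ![2, 2, k + 1] i)
      (by fin_cases i <;> simp))⟩
  refine ⟨fun i x => r i x * l i x, fun _ => 1, fun i => (hr i).1.mul (hl i), ?_, ?_,
    analyticAt_const, one_ne_zero, ?_⟩
  · intro i
    simp [hla]
  · have hd : (fun i => fderiv ℂ (fun x => r i x * l i x) a) =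
        fun i => (Units.mk0 (r i a) (hr i).2.1) • fderiv ℂ (l i) a := by
      funext i
      exact (hasFDerivAt_mul_of_eq_zero (hr i).1 (hl i) (hla i)).fderiv
    rw [hd]
    exact hli.units_smul _
  · filter_upwards [hf, (hr 0).2.2, (hr 1).2.2, (hr 2).2.2] with x hx h0 h1 h2
    simp only [Matrix.cons_val] at h0 h1 h2
    rw [hx, ← h0, ← h1, ← h2]
    ring

/-- The Morse lemma for a function that is given as a quadratic form with analytic coefficients,
in the position where two squares can be completed one after the other. -/
theorem isGermOfTypeA_one_of_quadratic {f : (Fin 3 → ℂ) → ℂ} {a : Fin 3 → ℂ}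
    {u : Fin 3 → (Fin 3 → ℂ) → ℂ} {A B C D E G : (Fin 3 → ℂ) → ℂ}
    (hu : ∀ i, AnalyticAt ℂ (u i) a) (hua : ∀ i, u i a = 0)
    (hui : LinearIndependent ℂ fun i => fderiv ℂ (u i) a)
    (hA : AnalyticAt ℂ A a) (hB : AnalyticAt ℂ B a) (hC : AnalyticAt ℂ C a)
    (hD : AnalyticAt ℂ D a) (hE : AnalyticAt ℂ E a) (hG : AnalyticAt ℂ G a)
    (hA0 : A a ≠ 0) (hC0 : 4 * A a * C a - B a ^ 2 ≠ 0)
    (hG0 : 4 * A a * C a * G a + B a * D a * E a - A a * E a ^ 2 - C a * D a ^ 2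
      - G a * B a ^ 2 ≠ 0)
    (hf : ∀ x, f x = A x * u 0 x ^ 2 + B x * (u 0 x * u 1 x) + C x * u 1 x ^ 2
      + D x * (u 0 x * u 2 x) + E x * (u 1 x * u 2 x) + G x * u 2 x ^ 2) :
    IsGermOfTypeA 1 f a := by
  have hM : AnalyticAt ℂ (fun x => 4 * A x * C x - B x ^ 2) a := by fun_prop
  have hN : AnalyticAt ℂ (fun x => 4 * A x * C x * G x + B x * D x * E x - A x * E x ^ 2
    - C x * D x ^ 2 - G x * B x ^ 2) a := by fun_prop
  have hβ : AnalyticAt ℂ (fun x => B x / (2 * A x)) a :=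
    hB.div (by fun_prop) (by simpa using hA0)
  have hδ : AnalyticAt ℂ (fun x => D x / (2 * A x)) a :=
    hD.div (by fun_prop) (by simpa using hA0)
  have hε : AnalyticAt ℂ (fun x => (2 * A x * E x - B x * D x) / (4 * A x * C x - B x ^ 2)) a :=
    AnalyticAt.div (by fun_prop) hM hC0
  have h0 := ((hu 0).differentiableAt.hasFDerivAt.add
    (hasFDerivAt_mul_of_eq_zero hβ (hu 1) (hua 1))).add
      (hasFDerivAt_mul_of_eq_zero hδ (hu 2) (hua 2))
  have h1 := (hu 1).differentiableAt.hasFDerivAt.add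
    (hasFDerivAt_mul_of_eq_zero hε (hu 2) (hua 2))
  refine isGermOfTypeA_of_sum_pow (a := a)
    (l := ![fun x => u 0 x + B x / (2 * A x) * u 1 x + D x / (2 * A x) * u 2 x,
      fun x => u 1 x + (2 * A x * E x - B x * D x) / (4 * A x * C x - B x ^ 2) * u 2 x, u 2])
    (P := ![A, fun x => (4 * A x * C x - B x ^ 2) / (4 * A x),
      fun x => (4 * A x * C x * G x + B x * D x * E x - A x * E x ^ 2
        - C x * D x ^ 2 - G x * B x ^ 2) / (4 * A x * C x - B x ^ 2)]) ?_ ?_ ?_ ?_ ?_ ?_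
  · have := hu 0
    have := hu 1
    have := hu 2
    intro i
    fin_cases i
    · exact ((hu 0).add (hβ.mul (hu 1))).add (hδ.mul (hu 2))
    · exact (hu 1).add (hε.mul (hu 2))
    · exact hu 2
  · intro i
    fin_cases i <;> simp [hua]
  · convert linearIndependent_triangular hui _ _ _ using 1
    funext i
    fin_cases i
    · exact h0.fderiv
    · exact h1.fderiv
    · rfl
    · rfl
  · intro i
    fin_cases i
    · exact hA
    · exact hM.div (by fun_prop) (by simpa using hA0)
    · exact hN.div hM hC0
  · intro i
    fin_cases i
    · exact hA0
    · exact div_ne_zero hC0 (by simpa using hA0)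
    · exact div_ne_zero hG0 hC0
  · filter_upwards [hA.continuousAt.eventually_ne hA0, hM.continuousAt.eventually_ne hC0]
      with x hx hx'
    rw [hf]
    simp only [Matrix.cons_val]
    obtain ⟨m, hm⟩ : ∃ m, 4 * A x * C x - B x ^ 2 = m := ⟨_, rfl⟩
    have hCx : C x = (m + B x ^ 2) / (4 * A x) := by
      rw [← hm]
      field_simp
      ring
    rw [hm] at hx'
    rw [hm, hCx]
    field_simp
    ring

/-- The splitting lemma for corank one in the position where two squares can be completed one
after the other: if `f` has no terms in `1`, `u`, `v`, `s`, `us`, `vs`, `s²`, its quadratic part in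
`u`, `v` is non-degenerate, and `s³` occurs, then `f` is of type `A₂`. -/
theorem isGermOfTypeA_two_of_quadratic_add_cube {f : (Fin 3 → ℂ) → ℂ} {a : Fin 3 → ℂ}
    {u : Fin 3 → (Fin 3 → ℂ) → ℂ} {A B C D E G : (Fin 3 → ℂ) → ℂ}
    (hu : ∀ i, AnalyticAt ℂ (u i) a) (hua : ∀ i, u i a = 0)
    (hui : LinearIndependent ℂ fun i => fderiv ℂ (u i) a)
    (hA : AnalyticAt ℂ A a) (hB : AnalyticAt ℂ B a) (hC : AnalyticAt ℂ C a)
    (hD : AnalyticAt ℂ D a) (hE : AnalyticAt ℂ E a) (hG : AnalyticAt ℂ G a)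
    (hA0 : A a ≠ 0) (hC0 : 4 * A a * C a - B a ^ 2 ≠ 0) (hG0 : G a ≠ 0)
    (hf : ∀ x, f x = A x * u 0 x ^ 2 + B x * (u 0 x * u 1 x) + C x * u 1 x ^ 2
      + D x * (u 0 x * u 2 x ^ 2) + E x * (u 1 x * u 2 x ^ 2) + G x * u 2 x ^ 3) :
    IsGermOfTypeA 2 f a := by
  have hM : AnalyticAt ℂ (fun x => 4 * A x * C x - B x ^ 2) a := by fun_prop
  have hu2 := hu 2
  have hβ : AnalyticAt ℂ (fun x => B x / (2 * A x)) a :=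
    hB.div (by fun_prop) (by simpa using hA0)
  have hδ : AnalyticAt ℂ (fun x => D x / (2 * A x) * u 2 x) a :=
    (hD.div (by fun_prop) (by simpa using hA0)).mul hu2
  have hε : AnalyticAt ℂ
      (fun x => (2 * A x * E x - B x * D x) / (4 * A x * C x - B x ^ 2) * u 2 x) a :=
    (AnalyticAt.div (by fun_prop) hM hC0).mul hu2
  have hN : AnalyticAt ℂ (fun x => G x - (A x * E x ^ 2 - B x * D x * E x + C x * D x ^ 2)
      / (4 * A x * C x - B x ^ 2) * u 2 x) a :=
    hG.sub ((AnalyticAt.div (by fun_prop) hM hC0).mul hu2)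
  have h0 := ((hu 0).differentiableAt.hasFDerivAt.add
    (hasFDerivAt_mul_of_eq_zero hβ (hu 1) (hua 1))).add
      (hasFDerivAt_mul_of_eq_zero hδ (hu 2) (hua 2))
  have h1 := (hu 1).differentiableAt.hasFDerivAt.add
    (hasFDerivAt_mul_of_eq_zero hε (hu 2) (hua 2))
  refine isGermOfTypeA_of_sum_pow (a := a)
    (l := ![fun x => u 0 x + B x / (2 * A x) * u 1 x + D x / (2 * A x) * u 2 x * u 2 x,
      fun x => u 1 x
        + (2 * A x * E x - B x * D x) / (4 * A x * C x - B x ^ 2) * u 2 x * u 2 x, u 2])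
    (P := ![A, fun x => (4 * A x * C x - B x ^ 2) / (4 * A x),
      fun x => G x - (A x * E x ^ 2 - B x * D x * E x + C x * D x ^ 2)
      / (4 * A x * C x - B x ^ 2) * u 2 x]) ?_ ?_ ?_ ?_ ?_ ?_
  · intro i
    fin_cases i
    · exact ((hu 0).add (hβ.mul (hu 1))).add (hδ.mul (hu 2))
    · exact (hu 1).add (hε.mul (hu 2))
    · exact hu 2
  · intro i
    fin_cases i <;> simp [hua]
  · convert linearIndependent_triangular hui _ _ _ using 1
    funext i
    fin_cases i
    · exact h0.fderiv
    · exact h1.fderiv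
    · rfl
    · rfl
  · intro i
    fin_cases i
    · exact hA
    · exact hM.div (by fun_prop) (by simpa using hA0)
    · exact hN
  · intro i
    fin_cases i
    · exact hA0
    · exact div_ne_zero hC0 (by simpa using hA0)
    · simpa [hua] using hG0
  · filter_upwards [hA.continuousAt.eventually_ne hA0, hM.continuousAt.eventually_ne hC0]
      with x hx hx'
    rw [hf]
    simp only [Matrix.cons_val]
    obtain ⟨m, hm⟩ : ∃ m, 4 * A x * C x - B x ^ 2 = m := ⟨_, rfl⟩
    have hCx : C x = (m + B x ^ 2) / (4 * A x) := by
      rw [← hm]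
      field_simp
      ring
    rw [hm] at hx'
    rw [hm, hCx]
    field_simp
    ring

@[fun_prop]
theorem analyticAt_coord (i : Fin 3) (a : Fin 3 → ℂ) :
    AnalyticAt ℂ (fun x : Fin 3 → ℂ => x i) a :=
  (ContinuousLinearMap.proj (R := ℂ) (φ := fun _ : Fin 3 => ℂ) i).analyticAt a

theorem linearIndependent_fderiv_coord (a : Fin 3 → ℂ) {σ : Fin 3 → Fin 3}
    (hσ : Function.Injective σ) :
    LinearIndependent ℂ fun i => fderiv ℂ (fun x : Fin 3 → ℂ => x (σ i) - a (σ i)) a := by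
  have hd : ∀ i, fderiv ℂ (fun x : Fin 3 → ℂ => x (σ i) - a (σ i)) a =
      ContinuousLinearMap.proj (R := ℂ) (φ := fun _ : Fin 3 => ℂ) (σ i) := fun i =>
    ((ContinuousLinearMap.proj (R := ℂ) (φ := fun _ : Fin 3 => ℂ)
      (σ i)).hasFDerivAt.sub_const _).fderiv
  simp only [hd]
  rw [Fintype.linearIndependent_iff]
  intro g hg i
  simpa [Pi.single_apply, hσ.eq_iff] using DFunLike.congr_fun hg (Pi.single (σ i) 1)

/-- The type of a germ does not change under a linear automorphism that multiplies the function by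
a constant. -/
theorem IsGermOfTypeA.of_semiinvariant {k : ℕ} {f : (Fin 3 → ℂ) → ℂ} {a : Fin 3 → ℂ}
    (h : IsGermOfTypeA k f a) (T : (Fin 3 → ℂ) ≃L[ℂ] (Fin 3 → ℂ)) {c : ℂ} (hc : c ≠ 0)
    (hf : ∀ x, f (T x) = c * f x) : IsGermOfTypeA k f (T a) := by
  obtain ⟨φ, g, hφ, hφa, hli, hg, hga, hfg⟩ := h
  have hT : AnalyticAt ℂ (fun x => T.symm x) (T a) := T.symm.analyticAt _
  have hTa : T.symm (T a) = a := T.symm_apply_apply a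
  have hφ' : ∀ i, AnalyticAt ℂ (φ i) (T.symm (T a)) := fun i => by rw [hTa]; exact hφ i
  refine ⟨fun i x => φ i (T.symm x), fun x => c * g (T.symm x),
    fun i => (hφ' i).comp hT, fun i => by simp [hφa], ?_,
    analyticAt_const.mul (AnalyticAt.comp (by rwa [hTa]) hT), by
      simpa [hc] using hga, ?_⟩
  · have hd : (fun i => fderiv ℂ (fun x => φ i (T.symm x)) (T a)) =
        fun i => (ContinuousLinearMap.precomp ℂ (T.symm : (Fin 3 → ℂ) →L[ℂ] (Fin 3 → ℂ)))
          (fderiv ℂ (φ i) a) := by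
      funext i
      have := (hφ' i).differentiableAt.hasFDerivAt.comp (T a) T.symm.hasFDerivAt
      rw [hTa] at this
      exact this.fderiv
    rw [hd]
    refine hli.map' (ContinuousLinearMap.precomp ℂ
      (T.symm : (Fin 3 → ℂ) →L[ℂ] (Fin 3 → ℂ))).toLinearMap ?_
    rw [LinearMap.ker_eq_bot]
    intro p q hpq
    refine ContinuousLinearMap.ext fun x => ?_
    simpa using DFunLike.congr_fun hpq (T x)
  · have ht : Filter.Tendsto (fun x => T.symm x) (𝓝 (T a)) (𝓝 a) := by
      simpa only [hTa] using hT.continuousAt.tendsto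
    filter_upwards [ht.eventually hfg] with x hx
    rw [← T.apply_symm_apply x, hf, hx, T.symm_apply_apply]
    ring

/-! ### The equations as polynomial functions -/

/-- The quartic form, with its coefficients expressed through `φ = 1 + e² + e³`, a root
of `φ² = φ + 1`. -/
def quarticForm (φ x y z w : ℂ) : ℂ :=
  x ^ 4 + (6 - 4 * φ) * x ^ 2 * z * w + (4 - 4 * φ) * x * y ^ 2 * w - (20 - 12 * φ) * x * y * z ^ 2
  + (8 - 4 * φ) * y ^ 3 * z - (12 - 8 * φ) * y * w ^ 3 + (13 - 8 * φ) * z ^ 2 * w ^ 2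

/-- The partial derivative of `quarticForm` with respect to `x`. -/
def quarticDx (φ x y z w : ℂ) : ℂ :=
  4 * x ^ 3 + (12 - 8 * φ) * x * z * w + (4 - 4 * φ) * y ^ 2 * w - (20 - 12 * φ) * y * z ^ 2

/-- The partial derivative of `quarticForm` with respect to `y`. -/
def quarticDy (φ x y z w : ℂ) : ℂ :=
  (8 - 8 * φ) * x * y * w - (20 - 12 * φ) * x * z ^ 2 + (24 - 12 * φ) * y ^ 2 * z
  - (12 - 8 * φ) * w ^ 3

/-- The partial derivative of `quarticForm` with respect to `z`. -/
def quarticDz (φ x y z w : ℂ) : ℂ :=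
  (6 - 4 * φ) * x ^ 2 * w - (40 - 24 * φ) * x * y * z + (8 - 4 * φ) * y ^ 3
  + (26 - 16 * φ) * z * w ^ 2

/-- The partial derivative of `quarticForm` with respect to `w`. -/
def quarticDw (φ x y z w : ℂ) : ℂ :=
  (6 - 4 * φ) * x ^ 2 * z + (4 - 4 * φ) * x * y ^ 2 - (36 - 24 * φ) * y * w ^ 2
  + (26 - 16 * φ) * z ^ 2 * w

/-- The quintic form, with its coefficients expressed through `φ = 1 + e² + e³`.
Its derivative with respect to `x` is five times the quartic form. -/
noncomputable def quinticForm (φ x y z w : ℂ) : ℂ :=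
  x ^ 5 + (10 - 20 / 3 * φ) * x ^ 3 * z * w + (10 - 10 * φ) * x ^ 2 * y ^ 2 * w
  - (50 - 30 * φ) * x ^ 2 * y * z ^ 2 + (40 - 20 * φ) * x * y ^ 3 * z
  - (60 - 40 * φ) * x * y * w ^ 3 + (65 - 40 * φ) * x * z ^ 2 * w ^ 2 - 4 / 3 * y ^ 5
  - (350 / 3 - 70 * φ) * y ^ 2 * z * w ^ 2 + (210 - 130 * φ) * y * z ^ 3 * w
  - (356 / 3 - 220 / 3 * φ) * z ^ 5 + (32 / 3 - 20 / 3 * φ) * w ^ 5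

/-- The partial derivative of `quinticForm` with respect to `y`. -/
noncomputable def quinticDy (φ x y z w : ℂ) : ℂ :=
  (20 - 20 * φ) * x ^ 2 * y * w - (50 - 30 * φ) * x ^ 2 * z ^ 2 + (120 - 60 * φ) * x * y ^ 2 * z
  - (60 - 40 * φ) * x * w ^ 3 - 20 / 3 * y ^ 4 - (700 / 3 - 140 * φ) * y * z * w ^ 2
  + (210 - 130 * φ) * z ^ 3 * w

/-- The partial derivative of `quinticForm` with respect to `z`. -/
noncomputable def quinticDz (φ x y z w : ℂ) : ℂ :=
  (10 - 20 / 3 * φ) * x ^ 3 * w - (100 - 60 * φ) * x ^ 2 * y * z + (40 - 20 * φ) * x * y ^ 3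
  + (130 - 80 * φ) * x * z * w ^ 2 - (350 / 3 - 70 * φ) * y ^ 2 * w ^ 2
  + (630 - 390 * φ) * y * z ^ 2 * w - (1780 / 3 - 1100 / 3 * φ) * z ^ 4

/-- The partial derivative of `quinticForm` with respect to `w`. -/
noncomputable def quinticDw (φ x y z w : ℂ) : ℂ :=
  (10 - 20 / 3 * φ) * x ^ 3 * z + (10 - 10 * φ) * x ^ 2 * y ^ 2 - (180 - 120 * φ) * x * y * w ^ 2
  + (130 - 80 * φ) * x * z ^ 2 * w - (700 / 3 - 140 * φ) * y ^ 2 * z * w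
  + (210 - 130 * φ) * y * z ^ 3 + (160 / 3 - 100 / 3 * φ) * w ^ 4

/-! ### Relations between the coordinates of a singular point of the quartic -/

/-- At a singular point of the quartic `y = 0` or `(x / y)⁵ = 1`. In this certificate and the
following ones, the multiple of `hφ` collects the reductions of `φ²` to `φ + 1`. -/
theorem quartic_relation_y {φ x y z w : ℂ} (hφ : φ ^ 2 = φ + 1)
    (hx : quarticDx φ x y z w = 0)
    (hy : quarticDy φ x y z w = 0)
    (hz : quarticDz φ x y z w = 0)
    (hw : quarticDw φ x y z w = 0) :
    y ^ 6 - x ^ 5 * y = 0 := by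
  unfold quarticDx at hx
  unfold quarticDy at hy
  unfold quarticDz at hz
  unfold quarticDw at hw
  linear_combination
    (-1 / 4 * x ^ 2 * y + (1 / 5 - 1 / 10 * φ) * x * w ^ 2
    - (9 / 40 - 3 / 20 * φ) * y * z * w) * hx + (-(1 / 20 - 1 / 40 * φ) * x ^ 2 * z
    + 7 / 40 * x * y ^ 2 - (1 / 5 - 1 / 8 * φ) * z ^ 2 * w) * hy + (1 / 5 * φ * x ^ 2 * w
    - 1 / 40 * x * y * z + (1 / 4 + 1 / 4 * φ) * y ^ 3 - (1 / 10 - 1 / 20 * φ) * z * w ^ 2) * hz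
    + (-1 / 40 * x * y * w - (3 / 20 - 1 / 10 * φ) * x * z ^ 2) * hw + (4 / 5 * x ^ 4 * w ^ 2
    - 23 / 5 * x ^ 3 * y * z * w + 1 / 10 * x ^ 3 * z ^ 3 + 9 / 5 * x ^ 2 * y ^ 3 * w
    + 7 / 10 * x ^ 2 * y ^ 2 * z ^ 2 + 12 / 5 * x ^ 2 * z * w ^ 3 - 6 * x * y ^ 4 * z
    - 2 / 5 * x * y ^ 2 * w ^ 3 - 1 / 5 * x * y * z ^ 2 * w ^ 2 + 1 / 10 * x * z ^ 4 * w + y ^ 6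
    + 24 / 5 * y ^ 3 * z * w ^ 2 - 3 / 10 * y ^ 2 * z ^ 3 * w - 1 / 5 * z ^ 2 * w ^ 4) * hφ

/-- For `y ≠ 0` this is a quadratic equation for `x z`; it factors as
`(x z - y²) (x z - (2 + 3 φ) y²) = 0`. -/
theorem quartic_relation_z {φ x y z w : ℂ} (hφ : φ ^ 2 = φ + 1)
    (hx : quarticDx φ x y z w = 0)
    (hy : quarticDy φ x y z w = 0)
    (hz : quarticDz φ x y z w = 0)
    (hw : quarticDw φ x y z w = 0) :
    x ^ 2 * y * z ^ 2 - (3 + 3 * φ) * x * y ^ 3 * z + (2 + 3 * φ) * y ^ 5 = 0 := by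
  unfold quarticDx at hx
  unfold quarticDy at hy
  unfold quarticDz at hz
  unfold quarticDw at hw
  linear_combination
    (-1 / 40 * φ * z * w) * hx + (-(3 / 20 + 9 / 40 * φ) * x * y) * hy
    + (-(3 / 20 + 9 / 40 * φ) * x * z + (5 / 4 + 2 * φ) * y ^ 2) * hz
    + ((1 / 20 + 3 / 40 * φ) * x * w - (1 / 20 + 1 / 10 * φ) * y * z) * hw
    + (-3 / 5 * x ^ 3 * z * w + 13 / 2 * x ^ 2 * y ^ 2 * w + 77 / 10 * x ^ 2 * y * z ^ 2
    - 52 * x * y ^ 3 * z - 13 / 5 * x * z ^ 2 * w ^ 2 + 8 * y ^ 5 + 343 / 10 * y ^ 2 * z * w ^ 2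
    - 13 / 10 * y * z ^ 3 * w) * hφ

/-- For `x, y ≠ 0` this relation determines `w` by `x`, `y`, `z`. -/
theorem quartic_relation_w {φ x y z w : ℂ} (hφ : φ ^ 2 = φ + 1)
    (hx : quarticDx φ x y z w = 0)
    (hy : quarticDy φ x y z w = 0)
    (hz : quarticDz φ x y z w = 0)
    (hw : quarticDw φ x y z w = 0) :
    x * ((1 + 3 * φ) * x ^ 2 * y * w + (2 + φ) * x * y ^ 2 * z - (3 + 4 * φ) * y ^ 4) = 0 := by
  unfold quarticDx at hx
  unfold quarticDy at hy
  unfold quarticDz at hz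
  unfold quarticDw at hw
  linear_combination
    ((1 / 10 + 3 / 10 * φ) * y * w) * hx + (-(3 / 40 + 1 / 10 * φ) * x ^ 2
    - (1 / 40 - 1 / 20 * φ) * z * w) * hy + (-(7 / 5 + 11 / 5 * φ) * x * y
    - (3 / 20 + 1 / 5 * φ) * w ^ 2) * hz + ((1 / 20 + 3 / 20 * φ) * x * z
    + (1 / 5 + 7 / 20 * φ) * y ^ 2) * hw + (-48 / 5 * x ^ 3 * y * w + 9 / 5 * x ^ 3 * z ^ 2
    + 268 / 5 * x ^ 2 * y ^ 2 * z - 37 / 5 * x * y ^ 4 - 156 / 5 * x * y * z * w ^ 2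
    + 9 / 5 * x * z ^ 3 * w - 8 * y ^ 3 * w ^ 2 + 13 / 5 * y ^ 2 * z ^ 2 * w
    - 18 / 5 * z * w ^ 4) * hφ

/-! ### Singular points of the quintic are singular on the quartic -/

/-- After multiplication by `x²`, the square of `quarticDx` lies in the Jacobian ideal of the
quintic; the same holds for the other partial derivatives of the quartic. That squares are needed
is due to the cusps: the Jacobian ideal of `u² + v² + s³` is `(u, v, s²)`, which contains the
square of the maximal ideal but not the maximal ideal itself. -/
theorem sq_quarticDx_of_quintic {φ x y z w : ℂ} (hφ : φ ^ 2 = φ + 1)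
    (h0 : quarticForm φ x y z w = 0) (hy : quinticDy φ x y z w = 0)
    (hz : quinticDz φ x y z w = 0) (hw : quinticDw φ x y z w = 0) :
    x ^ 2 * quarticDx φ x y z w ^ 2 = 0 := by
  unfold quarticForm at h0
  unfold quinticDy at hy
  unfold quinticDz at hz
  unfold quinticDw at hw
  unfold quarticDx
  linear_combination
    (16 * x ^ 4 + (336 / 25 - 224 / 25 * φ) * x ^ 2 * z * w
    + (144 / 5 - 432 / 25 * φ) * x * y * z ^ 2 - (32 / 25 - 16 / 25 * φ) * y ^ 3 * z
    - (192 / 25 - 128 / 25 * φ) * y * w ^ 3 + (208 / 25 - 128 / 25 * φ) * z ^ 2 * w ^ 2) * h0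
    + (-144 / 125 * x ^ 3 * y - (48 / 125 - 24 / 125 * φ) * x ^ 2 * w ^ 2
    - (144 / 125 - 96 / 125 * φ) * x * y * z * w + (624 / 125 - 384 / 125 * φ) * x * z ^ 3
    - (48 / 25 - 144 / 125 * φ) * y ^ 2 * z ^ 2 + (192 / 125 - 24 / 25 * φ) * z * w ^ 3) * hy
    + (-72 / 125 * x ^ 3 * z - (48 / 125 + 48 / 125 * φ) * x ^ 2 * y ^ 2 + 48 / 125 * x * y * w ^ 2
    + (216 / 125 - 144 / 125 * φ) * x * z ^ 2 * w + (96 / 125 - 48 / 125 * φ) * w ^ 4) * hz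
    + (-96 / 125 * x ^ 3 * w + (24 / 25 - 24 / 25 * φ) * x ^ 2 * y * z
    - (24 / 125 - 24 / 125 * φ) * y ^ 2 * w ^ 2 + (48 / 25 - 144 / 125 * φ) * y * z ^ 2 * w) * hw
    + (-64 / 25 * x ^ 5 * y ^ 2 * w - 32 / 5 * x ^ 5 * y * z ^ 2 + 336 / 25 * x ^ 4 * y ^ 3 * z
    + 96 / 25 * x ^ 4 * y * w ^ 3 + 368 / 25 * x ^ 4 * z ^ 2 * w ^ 2 - 192 / 25 * x ^ 3 * y ^ 5
    + 704 / 5 * x ^ 3 * y ^ 2 * z * w ^ 2 - 6336 / 25 * x ^ 3 * y * z ^ 3 * w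
    + 2304 / 25 * x ^ 3 * z ^ 5 - 256 / 25 * x ^ 3 * w ^ 5 + 224 / 5 * x ^ 2 * y ^ 4 * w ^ 2
    - 896 / 5 * x ^ 2 * y ^ 3 * z ^ 2 * w + 3712 / 25 * x ^ 2 * y ^ 2 * z ^ 4
    + 32 / 5 * x ^ 2 * y * z * w ^ 4 - 192 / 25 * x ^ 2 * z ^ 3 * w ^ 3
    + 64 / 25 * x * y ^ 5 * z * w - 192 / 25 * x * y ^ 4 * z ^ 3 - 256 / 25 * x * y ^ 3 * w ^ 4
    + 1984 / 25 * x * y ^ 2 * z ^ 2 * w ^ 3 - 2208 / 25 * x * y * z ^ 4 * w ^ 2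
    + 576 / 25 * x * z ^ 6 * w + 192 / 25 * x * z * w ^ 6 + 64 / 25 * y ^ 6 * z ^ 2
    - 288 / 25 * y ^ 4 * z * w ^ 3 + 48 / 5 * y ^ 3 * z ^ 3 * w ^ 2 - 192 / 25 * y ^ 2 * w ^ 6
    + 704 / 25 * y * z ^ 2 * w ^ 5 - 624 / 25 * z ^ 4 * w ^ 4) * hφ

theorem sq_quarticDy_of_quintic {φ x y z w : ℂ} (hφ : φ ^ 2 = φ + 1)
    (h0 : quarticForm φ x y z w = 0) (hy : quinticDy φ x y z w = 0)
    (hz : quinticDz φ x y z w = 0) (hw : quinticDw φ x y z w = 0) :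
    x ^ 2 * quarticDy φ x y z w ^ 2 = 0 := by
  unfold quarticForm at h0
  unfold quinticDy at hy
  unfold quinticDz at hz
  unfold quinticDw at hw
  unfold quarticDy
  linear_combination
    (-(8 / 5 - 8 / 5 * φ) * x ^ 3 * w + (128 / 5 - 64 / 5 * φ) * x ^ 2 * y * z
    - (192 / 5 - 576 / 25 * φ) * x * z * w ^ 2 + (576 / 25 - 288 / 25 * φ) * y ^ 2 * w ^ 2
    - (6528 / 25 - 816 / 5 * φ) * y * z ^ 2 * w + (5712 / 25 - 3528 / 25 * φ) * z ^ 4) * h0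
    + ((36 / 125 - 36 / 125 * φ) * x ^ 2 * y * w - (156 / 25 - 468 / 125 * φ) * x ^ 2 * z ^ 2
    + (864 / 125 - 432 / 125 * φ) * x * y ^ 2 * z - (216 / 125 - 144 / 125 * φ) * x * w ^ 3
    + (192 / 25 - 576 / 125 * φ) * y * z * w ^ 2 - (1764 / 125 - 1092 / 125 * φ) * z ^ 3 * w) * hy
    + ((12 / 25 + 12 / 25 * φ) * x ^ 4 + (144 / 125 - 144 / 125 * φ) * x ^ 2 * z * w
    - (1008 / 125 - 504 / 125 * φ) * x * y * z ^ 2 + 144 / 125 * y ^ 3 * z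
    - (48 / 25 - 48 / 25 * φ) * y * w ^ 3) * hz + (24 / 25 * φ * x ^ 3 * y
    + (84 / 125 - 84 / 125 * φ) * x ^ 2 * w ^ 2 - (288 / 125 - 144 / 125 * φ) * x * y * z * w
    + 24 / 125 * y ^ 3 * w - (144 / 25 - 96 / 25 * φ) * y ^ 2 * z ^ 2) * hw + (16 / 5 * x ^ 7 * w
    - 112 / 5 * x ^ 6 * y * z + 96 / 5 * x ^ 5 * y ^ 3 + 816 / 25 * x ^ 5 * z * w ^ 2
    - 2272 / 25 * x ^ 4 * y ^ 2 * w ^ 2 + 944 / 5 * x ^ 4 * y * z ^ 2 * w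
    - 3608 / 25 * x ^ 4 * z ^ 4 - 2128 / 25 * x ^ 3 * y ^ 3 * z * w
    + 512 / 5 * x ^ 3 * y ^ 2 * z ^ 3 + 96 / 5 * x ^ 3 * y * w ^ 4
    - 832 / 25 * x ^ 3 * z ^ 2 * w ^ 3 + 112 / 25 * x ^ 2 * y ^ 4 * z ^ 2
    + 832 / 25 * x ^ 2 * y ^ 2 * z * w ^ 3 - 2416 / 25 * x ^ 2 * y * z ^ 3 * w ^ 2
    + 2064 / 25 * x ^ 2 * z ^ 5 * w - 112 / 25 * x ^ 2 * w ^ 6 - 192 / 25 * x * y ^ 4 * w ^ 3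
    + 4656 / 25 * x * y ^ 3 * z ^ 2 * w ^ 2 - 10464 / 25 * x * y ^ 2 * z ^ 4 * w
    + 5376 / 25 * x * y * z ^ 6 + 768 / 25 * x * y * z * w ^ 5 - 384 / 25 * x * z ^ 3 * w ^ 4
    - 1152 / 25 * y ^ 5 * z * w ^ 2 + 576 / 5 * y ^ 4 * z ^ 3 * w - 1632 / 25 * y ^ 3 * z ^ 5
    - 1056 / 25 * y ^ 3 * w ^ 5 + 3104 / 25 * y ^ 2 * z ^ 2 * w ^ 4 - 2288 / 25 * y * z ^ 4 * w ^ 3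
    + 168 / 25 * z ^ 6 * w ^ 2) * hφ

theorem sq_quarticDz_of_quintic {φ x y z w : ℂ} (hφ : φ ^ 2 = φ + 1)
    (h0 : quarticForm φ x y z w = 0) (hy : quinticDy φ x y z w = 0)
    (hz : quinticDz φ x y z w = 0) (hw : quinticDw φ x y z w = 0) :
    x ^ 2 * quarticDz φ x y z w ^ 2 = 0 := by
  unfold quarticForm at h0
  unfold quinticDy at hy
  unfold quinticDz at hz
  unfold quinticDw at hw
  unfold quarticDz
  linear_combination
    (-(572 / 25 - 352 / 25 * φ) * x ^ 2 * w ^ 2 - (1176 / 25 - 728 / 25 * φ) * x * y * z * w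
    + (7832 / 25 - 968 / 5 * φ) * x * z ^ 3 - (576 / 25 - 72 / 5 * φ) * y ^ 3 * w
    + (272 / 25 - 168 / 25 * φ) * y ^ 2 * z ^ 2 - (352 / 5 - 1088 / 25 * φ) * z * w ^ 3) * h0
    + ((884 / 125 - 544 / 125 * φ) * x ^ 3 * z - (12 / 5 - 36 / 25 * φ) * x ^ 2 * y ^ 2
    - (312 / 25 - 192 / 25 * φ) * x * y * w ^ 2 + (924 / 25 - 2856 / 125 * φ) * x * z ^ 2 * w
    + (168 / 125 - 104 / 125 * φ) * y ^ 2 * z * w - (2136 / 125 - 264 / 25 * φ) * y * z ^ 3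
    + (544 / 125 - 336 / 125 * φ) * w ^ 4) * hy + ((648 / 125 - 432 / 125 * φ) * x ^ 3 * w
    - (24 / 5 - 72 / 25 * φ) * x ^ 2 * y * z + (192 / 125 - 96 / 125 * φ) * x * y ^ 3
    + (2496 / 125 - 1536 / 125 * φ) * x * z * w ^ 2 + (48 / 25 - 144 / 125 * φ) * y ^ 2 * w ^ 2
    - (756 / 125 - 468 / 125 * φ) * y * z ^ 2 * w) * hz
    + (-(108 / 25 - 324 / 125 * φ) * x ^ 2 * y * w + (1512 / 125 - 936 / 125 * φ) * x ^ 2 * z ^ 2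
    + (384 / 125 - 48 / 25 * φ) * x * y ^ 2 * z + (624 / 125 - 384 / 125 * φ) * x * w ^ 3
    - (96 / 125 - 64 / 125 * φ) * y ^ 4 + (336 / 125 - 208 / 125 * φ) * y * z * w ^ 2) * hw
    + (-176 / 25 * x ^ 6 * w ^ 2 - 176 / 5 * x ^ 5 * y * z * w + 2016 / 25 * x ^ 5 * z ^ 3
    + 312 / 25 * x ^ 4 * y ^ 3 * w + 56 / 5 * x ^ 4 * y ^ 2 * z ^ 2 - 512 / 25 * x ^ 4 * z * w ^ 3
    - 1328 / 75 * x ^ 3 * y ^ 4 * z + 224 / 5 * x ^ 3 * y ^ 2 * w ^ 3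
    - 2384 / 15 * x ^ 3 * y * z ^ 2 * w ^ 2 + 336 / 25 * x ^ 3 * z ^ 4 * w
    + 144 / 25 * x ^ 2 * y ^ 6 + 304 / 25 * x ^ 2 * y ^ 3 * z * w ^ 2
    + 32 * x ^ 2 * y ^ 2 * z ^ 3 * w - 576 / 25 * x ^ 2 * y * z ^ 5 - 464 / 25 * x ^ 2 * y * w ^ 5
    + 1472 / 25 * x ^ 2 * z ^ 2 * w ^ 4 + 672 / 25 * x * y ^ 5 * w ^ 2 - 48 * x * y ^ 4 * z ^ 2 * w
    - 704 / 25 * x * y ^ 3 * z ^ 4 + 1792 / 25 * x * y ^ 2 * z * w ^ 4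
    + 224 / 25 * x * y * z ^ 3 * w ^ 3 - 336 / 25 * x * z ^ 5 * w ^ 2 + 128 / 25 * x * w ^ 7
    - 352 / 25 * y ^ 6 * z * w + 992 / 25 * y ^ 5 * z ^ 3 - 1312 / 75 * y ^ 4 * w ^ 4
    - 472 / 25 * y ^ 3 * z ^ 2 * w ^ 3 + 648 / 25 * y ^ 2 * z ^ 4 * w ^ 2
    - 2048 / 75 * y * z * w ^ 6 - 32 / 25 * z ^ 3 * w ^ 5) * hφ

theorem sq_quarticDw_of_quintic {φ x y z w : ℂ} (hφ : φ ^ 2 = φ + 1)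
    (h0 : quarticForm φ x y z w = 0) (hy : quinticDy φ x y z w = 0)
    (hz : quinticDz φ x y z w = 0) (hw : quinticDw φ x y z w = 0) :
    x ^ 2 * quarticDw φ x y z w ^ 2 = 0 := by
  unfold quarticForm at h0
  unfold quinticDy at hy
  unfold quinticDz at hz
  unfold quinticDw at hw
  unfold quarticDw
  linear_combination
    ((672 / 25 - 448 / 25 * φ) * x ^ 2 * y * w - (1092 / 25 - 672 / 25 * φ) * x ^ 2 * z ^ 2
    + (912 / 5 - 2736 / 25 * φ) * x * y ^ 2 * z - (2304 / 25 - 288 / 5 * φ) * x * w ^ 3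
    - (224 / 25 - 112 / 25 * φ) * y ^ 4 - (6032 / 25 - 3712 / 25 * φ) * y * z * w ^ 2
    + (1408 / 5 - 4352 / 25 * φ) * z ^ 3 * w) * h0 + (-(24 / 25 - 12 / 25 * φ) * x ^ 4
    - (96 / 25 - 12 / 5 * φ) * x ^ 2 * z * w - (576 / 125 - 384 / 125 * φ) * x * y ^ 2 * w
    + (3432 / 125 - 2112 / 125 * φ) * x * y * z ^ 2 - (336 / 25 - 1008 / 125 * φ) * y ^ 3 * z
    + (1344 / 125 - 168 / 25 * φ) * y * w ^ 3) * hy + (24 / 125 * x ^ 3 * y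
    + (144 / 125 - 72 / 125 * φ) * x ^ 2 * w ^ 2 + (576 / 125 - 384 / 125 * φ) * x * y * z * w
    + (48 / 125 - 48 / 125 * φ) * y ^ 3 * w + (72 / 25 - 216 / 125 * φ) * y ^ 2 * z ^ 2
    + (768 / 125 - 96 / 25 * φ) * z * w ^ 3) * hz + ((288 / 125 - 192 / 125 * φ) * x ^ 3 * z
    + (168 / 125 - 168 / 125 * φ) * x ^ 2 * y ^ 2 - (216 / 25 - 144 / 25 * φ) * x * y * w ^ 2
    + (936 / 125 - 576 / 125 * φ) * x * z ^ 2 * w + (24 / 5 - 72 / 25 * φ) * y ^ 2 * z * w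
    + (1008 / 125 - 624 / 125 * φ) * y * z ^ 3) * hw + (48 / 5 * x ^ 6 * y * w
    - 216 / 25 * x ^ 6 * z ^ 2 + 912 / 25 * x ^ 5 * y ^ 2 * z - 576 / 25 * x ^ 5 * w ^ 3
    + 64 / 25 * x ^ 4 * y ^ 4 - 1152 / 25 * x ^ 4 * y * z * w ^ 2 + 1808 / 25 * x ^ 4 * z ^ 3 * w
    + 64 / 25 * x ^ 3 * y ^ 3 * w ^ 2 - 1456 / 25 * x ^ 3 * y ^ 2 * z ^ 2 * w
    - 1216 / 25 * x ^ 3 * y * z ^ 4 + 288 / 25 * x ^ 3 * z * w ^ 4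
    - 624 / 25 * x ^ 2 * y ^ 4 * z * w + 1104 / 25 * x ^ 2 * y ^ 3 * z ^ 3
    - 16 / 5 * x ^ 2 * y ^ 2 * w ^ 4 + 2288 / 25 * x ^ 2 * y * z ^ 2 * w ^ 3
    - 1768 / 25 * x ^ 2 * z ^ 4 * w ^ 2 + 256 / 25 * x * y ^ 6 * w - 1056 / 25 * x * y ^ 5 * z ^ 2
    + 4768 / 25 * x * y ^ 3 * z * w ^ 3 - 4064 / 25 * x * y ^ 2 * z ^ 3 * w ^ 2
    + 512 / 25 * x * y * z ^ 5 * w + 448 / 25 * y ^ 7 * z - 224 / 25 * y ^ 5 * w ^ 3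
    - 624 / 5 * y ^ 4 * z ^ 2 * w ^ 2 + 3584 / 25 * y ^ 3 * z ^ 4 * w - 384 / 25 * y ^ 2 * z ^ 6
    - 1856 / 25 * y ^ 2 * z * w ^ 5 + 1072 / 25 * y * z ^ 3 * w ^ 4
    + 384 / 25 * z ^ 5 * w ^ 3) * hφ

/-- There is no singular point of the quintic with `x = 0`: the seventh powers of `y`, `z`, `w` lie
in the Jacobian ideal restricted to this plane. -/
theorem y_eq_zero_of_quintic {φ y z w : ℂ} (hφ : φ ^ 2 = φ + 1)
    (h0 : quarticForm φ 0 y z w = 0) (hy : quinticDy φ 0 y z w = 0)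
    (hz : quinticDz φ 0 y z w = 0) (hw : quinticDw φ 0 y z w = 0) :
    y = 0 := by
  unfold quarticForm at h0
  unfold quinticDy at hy
  unfold quinticDz at hz
  unfold quinticDw at hw
  refine pow_eq_zero_iff (n := 7) (by norm_num) |>.1 ?_
  linear_combination
    ((2 / 25 - 1 / 25 * φ) * y * w ^ 2) * h0 + (-3 / 20 * y ^ 3
    + (3 / 25 - 9 / 125 * φ) * z * w ^ 2) * hy + ((9 / 250 - 9 / 250 * φ) * w ^ 3) * hz
    + (3 / 20 * y ^ 2 * w) * hw + (-4 / 25 * y ^ 4 * z * w ^ 2 + 71 / 25 * y ^ 2 * w ^ 5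
    - 107 / 25 * y * z ^ 2 * w ^ 4 + 96 / 25 * z ^ 4 * w ^ 3) * hφ

theorem z_eq_zero_of_quintic {φ y z w : ℂ} (hφ : φ ^ 2 = φ + 1)
    (h0 : quarticForm φ 0 y z w = 0) (hy : quinticDy φ 0 y z w = 0)
    (hz : quinticDz φ 0 y z w = 0) (hw : quinticDw φ 0 y z w = 0) :
    z = 0 := by
  unfold quarticForm at h0
  unfold quinticDy at hy
  unfold quinticDz at hz
  unfold quinticDw at hw
  refine pow_eq_zero_iff (n := 7) (by norm_num) |>.1 ?_
  linear_combination
    (-(6141 / 50 + 4968 / 25 * φ) * y ^ 2 * z - (737 / 5 + 5963 / 25 * φ) * w ^ 3) * h0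
    + (-(3519 / 125 + 2277 / 50 * φ) * y * z ^ 2) * hy + ((9072 / 25 + 14679 / 25 * φ) * y * z * w
    - (51 / 10 + 33 / 4 * φ) * z ^ 3) * hz + (-(28944 / 125 + 46833 / 125 * φ) * y * w ^ 2
    - (3417 / 250 + 2211 / 100 * φ) * z ^ 2 * w) * hw + (-19872 / 25 * y ^ 5 * z ^ 2
    + 299686 / 25 * y ^ 3 * z * w ^ 3 + 9437241 / 50 * y ^ 2 * z ^ 3 * w ^ 2
    - 227304 * y * z ^ 5 * w - 264516 / 25 * y * w ^ 6 + 3025 * z ^ 7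
    - 66129 / 25 * z ^ 2 * w ^ 5) * hφ

theorem w_eq_zero_of_quintic {φ y z w : ℂ} (hφ : φ ^ 2 = φ + 1)
    (h0 : quarticForm φ 0 y z w = 0) (hy : quinticDy φ 0 y z w = 0)
    (hz : quinticDz φ 0 y z w = 0) (hw : quinticDw φ 0 y z w = 0) :
    w = 0 := by
  unfold quarticForm at h0
  unfold quinticDy at hy
  unfold quinticDz at hz
  unfold quinticDw at hw
  refine pow_eq_zero_iff (n := 7) (by norm_num) |>.1 ?_
  linear_combination
    (-(14 / 25 + 21 / 25 * φ) * y * z * w - 3 / 50 * φ * z ^ 3) * h0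
    + ((189 / 500 + 63 / 100 * φ) * y * w ^ 2 - (3 / 500 + 3 / 500 * φ) * z ^ 2 * w) * hy
    + (-(189 / 250 + 153 / 125 * φ) * y ^ 3) * hz + (-(9 / 20 + 3 / 4 * φ) * w ^ 3) * hw
    + (2142 / 25 * y ^ 5 * w ^ 2 - 12018 / 25 * y ^ 4 * z ^ 2 * w + 11214 / 25 * y ^ 3 * z ^ 4
    + 588 / 25 * y ^ 2 * z * w ^ 4 - 21 * y * z ^ 3 * w ^ 3 - 63 / 50 * z ^ 5 * w ^ 2
    - 25 * w ^ 7) * hφ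

/-! ### Taylor expansions in the chart `w = 1` -/

/-- Taylor expansion of the quartic at a singular point of the chart `w = 1`: the germ is a node if
the Hessian is non-degenerate, where its leading principal minors are required not to vanish. -/
theorem quarticForm_germ {φ : ℂ} {a : Fin 3 → ℂ}
    (h0 : quarticForm φ (a 0) (a 1) (a 2) 1 = 0) (hx : quarticDx φ (a 0) (a 1) (a 2) 1 = 0)
    (hy : quarticDy φ (a 0) (a 1) (a 2) 1 = 0) (hz : quarticDz φ (a 0) (a 1) (a 2) 1 = 0)
    (h1 : 6 * a 0 ^ 2 + (6 - 4 * φ) * a 2 ≠ 0)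
    (h2 : 4 * (6 * a 0 ^ 2 + (6 - 4 * φ) * a 2) * ((4 - 4 * φ) * a 0 + (24 - 12 * φ) * a 1 * a 2)
    - ((8 - 8 * φ) * a 1 - (20 - 12 * φ) * a 2 ^ 2) ^ 2 ≠ 0)
    (h3 : 4 * (6 * a 0 ^ 2 + (6 - 4 * φ) * a 2) * ((4 - 4 * φ) * a 0 + (24 - 12 * φ) * a 1 * a 2) *
    (-(20 - 12 * φ) * a 0 * a 1 + (13 - 8 * φ)) + ((8 - 8 * φ) * a 1 - (20 - 12 * φ) * a 2 ^ 2) *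
    ((12 - 8 * φ) * a 0 - (40 - 24 * φ) * a 1 * a 2) * (-(40 - 24 * φ) * a 0 * a 2
    + (24 - 12 * φ) * a 1 ^ 2) - (6 * a 0 ^ 2 + (6 - 4 * φ) * a 2) * (-(40 - 24 * φ) * a 0 * a 2
    + (24 - 12 * φ) * a 1 ^ 2) ^ 2 - ((4 - 4 * φ) * a 0 + (24 - 12 * φ) * a 1 * a 2) *
    ((12 - 8 * φ) * a 0 - (40 - 24 * φ) * a 1 * a 2) ^ 2 - (-(20 - 12 * φ) * a 0 * a 1
    + (13 - 8 * φ)) * ((8 - 8 * φ) * a 1 - (20 - 12 * φ) * a 2 ^ 2) ^ 2 ≠ 0) :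
    IsGermOfTypeA 1 (fun x => quarticForm φ (x 0) (x 1) (x 2) 1) a := by
  unfold quarticForm at h0
  unfold quarticDx at hx
  unfold quarticDy at hy
  unfold quarticDz at hz
  -- the higher terms of the expansion are distributed among the coefficients of the quadratic form
  refine isGermOfTypeA_one_of_quadratic (a := a)
    (u := fun i x => x (![0, 1, 2] i) - a (![0, 1, 2] i))
    (A := fun x =>
      6 * a 0 ^ 2 + 4 * a 0 * (x 0 - a 0) + (6 - 4 * φ) * a 2 + (x 0 - a 0) ^ 2
      + (6 - 4 * φ) * (x 2 - a 2))
    (B := fun x =>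
      (8 - 8 * φ) * a 1 - (20 - 12 * φ) * a 2 ^ 2 - (40 - 24 * φ) * a 2 * (x 2 - a 2)
      + (4 - 4 * φ) * (x 1 - a 1) - (20 - 12 * φ) * (x 2 - a 2) ^ 2)
    (C := fun x =>
      (4 - 4 * φ) * a 0 + (24 - 12 * φ) * a 1 * a 2 + (24 - 12 * φ) * a 1 * (x 2 - a 2)
      + (8 - 4 * φ) * a 2 * (x 1 - a 1) + (8 - 4 * φ) * (x 1 - a 1) * (x 2 - a 2))
    (D := fun x =>
      (12 - 8 * φ) * a 0 - (40 - 24 * φ) * a 1 * a 2 - (20 - 12 * φ) * a 1 * (x 2 - a 2))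
    (E := fun x =>
      -(40 - 24 * φ) * a 0 * a 2 - (20 - 12 * φ) * a 0 * (x 2 - a 2) + (24 - 12 * φ) * a 1 ^ 2)
    (G := fun x =>
      -(20 - 12 * φ) * a 0 * a 1 + (13 - 8 * φ))
    ?_ ?_ ?_ ?_ ?_ ?_ ?_ ?_ ?_ ?_ ?_ ?_ ?_
  · intro i
    fun_prop
  · intro i
    exact sub_self _
  · exact linearIndependent_fderiv_coord a (σ := ![0, 1, 2]) (by decide)
  iterate 6 · fun_prop
  · simpa using h1
  · simpa using h2
  · simpa using h3
  · intro x
    simp only [Matrix.cons_val, quarticForm]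
    linear_combination
      h0 + (x 0 - a 0) * hx + (x 1 - a 1) * hy + (x 2 - a 2) * hz

/-- Taylor expansion of the quintic at a point of the chart `w = 1` that is singular on both
surfaces. The derivative of the quintic with respect to `x` is five times the quartic, so that the
second derivatives involving `x` vanish there: the direction `x` lies in the kernel of the Hessian,
and the germ is of type `A₂` if the Hessian is non-degenerate in `y`, `z` and the third derivative
along `x` does not vanish. -/
theorem quinticForm_germ {φ : ℂ} {a : Fin 3 → ℂ}
    (h0 : quarticForm φ (a 0) (a 1) (a 2) 1 = 0) (hx : quarticDx φ (a 0) (a 1) (a 2) 1 = 0)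
    (hy : quarticDy φ (a 0) (a 1) (a 2) 1 = 0) (hz : quarticDz φ (a 0) (a 1) (a 2) 1 = 0)
    (hS : quinticForm φ (a 0) (a 1) (a 2) 1 = 0)
    (hSy : quinticDy φ (a 0) (a 1) (a 2) 1 = 0) (hSz : quinticDz φ (a 0) (a 1) (a 2) 1 = 0)
    (h1 : -(50 - 30 * φ) * a 0 ^ 2 * a 1 + (65 - 40 * φ) * a 0 + (630 - 390 * φ) * a 1 * a 2
    - (3560 / 3 - 2200 / 3 * φ) * a 2 ^ 3 ≠ 0)
    (h2 : 4 * (-(50 - 30 * φ) * a 0 ^ 2 * a 1 + (65 - 40 * φ) * a 0 + (630 - 390 * φ) * a 1 * a 2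
    - (3560 / 3 - 2200 / 3 * φ) * a 2 ^ 3) * ((10 - 10 * φ) * a 0 ^ 2
    + (120 - 60 * φ) * a 0 * a 1 * a 2 - 40 / 3 * a 1 ^ 3 - (350 / 3 - 70 * φ) * a 2)
    - (-(100 - 60 * φ) * a 0 ^ 2 * a 2 + (120 - 60 * φ) * a 0 * a 1 ^ 2 - (700 / 3 - 140 * φ) * a 1
    + (630 - 390 * φ) * a 2 ^ 2) ^ 2 ≠ 0)
    (h3 : 10 * a 0 ^ 2 + (10 - 20 / 3 * φ) * a 2 ≠ 0) :
    IsGermOfTypeA 2 (fun x => quinticForm φ (x 0) (x 1) (x 2) 1) a := by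
  unfold quarticForm at h0
  unfold quarticDx at hx
  unfold quarticDy at hy
  unfold quarticDz at hz
  unfold quinticForm at hS
  unfold quinticDy at hSy
  unfold quinticDz at hSz
  -- the coordinate `x`, in the kernel of the Hessian, comes last
  refine isGermOfTypeA_two_of_quadratic_add_cube (a := a)
    (u := fun i x => x (![2, 1, 0] i) - a (![2, 1, 0] i))
    (A := fun x =>
      -(50 - 30 * φ) * a 0 ^ 2 * a 1 - (50 - 30 * φ) * a 0 ^ 2 * (x 1 - a 1)
      - (100 - 60 * φ) * a 0 * a 1 * (x 0 - a 0) - (100 - 60 * φ) * a 0 * (x 0 - a 0) * (x 1 - a 1)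
      + (65 - 40 * φ) * a 0 + (630 - 390 * φ) * a 1 * a 2 - (50 - 30 * φ) * a 1 * (x 0 - a 0) ^ 2
      + (210 - 130 * φ) * a 1 * (x 2 - a 2) - (3560 / 3 - 2200 / 3 * φ) * a 2 ^ 3
      - (3560 / 3 - 2200 / 3 * φ) * a 2 ^ 2 * (x 2 - a 2) + (630 - 390 * φ) * a 2 * (x 1 - a 1)
      - (1780 / 3 - 1100 / 3 * φ) * a 2 * (x 2 - a 2) ^ 2
      - (50 - 30 * φ) * (x 0 - a 0) ^ 2 * (x 1 - a 1) + (65 - 40 * φ) * (x 0 - a 0)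
      + (210 - 130 * φ) * (x 1 - a 1) * (x 2 - a 2) - (356 / 3 - 220 / 3 * φ) * (x 2 - a 2) ^ 3)
    (B := fun x =>
      -(100 - 60 * φ) * a 0 ^ 2 * a 2 + (120 - 60 * φ) * a 0 * a 1 ^ 2
      + (120 - 60 * φ) * a 0 * a 1 * (x 1 - a 1) - (200 - 120 * φ) * a 0 * a 2 * (x 0 - a 0)
      + (40 - 20 * φ) * a 0 * (x 1 - a 1) ^ 2 + (120 - 60 * φ) * a 1 ^ 2 * (x 0 - a 0)
      + (120 - 60 * φ) * a 1 * (x 0 - a 0) * (x 1 - a 1) - (700 / 3 - 140 * φ) * a 1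
      + (630 - 390 * φ) * a 2 ^ 2 - (100 - 60 * φ) * a 2 * (x 0 - a 0) ^ 2
      + (40 - 20 * φ) * (x 0 - a 0) * (x 1 - a 1) ^ 2 - (350 / 3 - 70 * φ) * (x 1 - a 1))
    (C := fun x =>
      (10 - 10 * φ) * a 0 ^ 2 + (120 - 60 * φ) * a 0 * a 1 * a 2
      + (40 - 20 * φ) * a 0 * a 2 * (x 1 - a 1) + (20 - 20 * φ) * a 0 * (x 0 - a 0)
      - 40 / 3 * a 1 ^ 3 - 40 / 3 * a 1 ^ 2 * (x 1 - a 1)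
      + (120 - 60 * φ) * a 1 * a 2 * (x 0 - a 0) - 20 / 3 * a 1 * (x 1 - a 1) ^ 2
      + (40 - 20 * φ) * a 2 * (x 0 - a 0) * (x 1 - a 1) - (350 / 3 - 70 * φ) * a 2
      + (10 - 10 * φ) * (x 0 - a 0) ^ 2 - 4 / 3 * (x 1 - a 1) ^ 3)
    (D := fun x =>
      (30 - 20 * φ) * a 0 - (100 - 60 * φ) * a 1 * a 2 + (10 - 20 / 3 * φ) * (x 0 - a 0))
    (E := fun x =>
      (20 - 20 * φ) * a 1 - (50 - 30 * φ) * a 2 ^ 2)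
    (G := fun x =>
      10 * a 0 ^ 2 + 5 * a 0 * (x 0 - a 0) + (10 - 20 / 3 * φ) * a 2 + (x 0 - a 0) ^ 2)
    ?_ ?_ ?_ ?_ ?_ ?_ ?_ ?_ ?_ ?_ ?_ ?_ ?_
  · intro i
    fun_prop
  · intro i
    exact sub_self _
  · exact linearIndependent_fderiv_coord a (σ := ![2, 1, 0]) (by decide)
  iterate 6 · fun_prop
  · simpa using h1
  · simpa using h2
  · simpa using h3
  · intro x
    simp only [Matrix.cons_val, quinticForm]
    linear_combination
      hS + 5 * (x 0 - a 0) * h0 + (x 1 - a 1) * hSy + (x 2 - a 2) * hSz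
      + 5 / 2 * (x 0 - a 0) ^ 2 * hx + 5 * (x 0 - a 0) * (x 1 - a 1) * hy
      + 5 * (x 0 - a 0) * (x 2 - a 2) * hz

/-! ### The nodes and the cusps -/

/-- A number `p + q φ` with rational `p`, `q` vanishes only if its norm `p² + pq - q²` does. -/
theorem add_mul_golden_ne_zero {φ : ℂ} (hφ : φ ^ 2 = φ + 1) (p q : ℚ)
    (h : p ^ 2 + p * q - q ^ 2 ≠ 0) : (p : ℂ) + q * φ ≠ 0 := by
  intro h0
  have h1 : ((p ^ 2 + p * q - q ^ 2 : ℚ) : ℂ) = 0 := by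
    push_cast
    linear_combination (p + q - q * φ) * h0 + q ^ 2 * hφ
  exact h (by exact_mod_cast h1)

/-- Representatives, in the chart `w = 1`, of the three orbits of nodes that are not fixed. -/
def nodeBase (φ : ℂ) : Fin 3 → Fin 3 → ℂ :=
  ![![1, 1, 1], ![φ - 2, φ - 2, -1 - φ], ![φ - 1, 0, φ]]

/-- The orbit of the `j`-th representative, in the chart `w = 1`. The linear automorphism
`(x, ey, e²z, e³w)` acts on this chart as `(η³x, η²y, ηz)` with `η = e⁻¹`, and the orbit is
parametrized by the fifth roots of unity `η`. -/
def nodePoint (φ : ℂ) (j : Fin 3) (η : ℂ) : Fin 3 → ℂ :=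
  ![η ^ 3 * nodeBase φ j 0, η ^ 2 * nodeBase φ j 1, η * nodeBase φ j 2]

theorem quarticForm_nodeBase {φ : ℂ} (hφ : φ ^ 2 = φ + 1) (j : Fin 3) :
    quarticForm φ (nodeBase φ j 0) (nodeBase φ j 1) (nodeBase φ j 2) 1 = 0 := by
  fin_cases j <;> simp [nodeBase, quarticForm] <;> grind

theorem quarticDx_nodeBase {φ : ℂ} (hφ : φ ^ 2 = φ + 1) (j : Fin 3) :
    quarticDx φ (nodeBase φ j 0) (nodeBase φ j 1) (nodeBase φ j 2) 1 = 0 := by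
  fin_cases j <;> simp [nodeBase, quarticDx] <;> grind

theorem quarticDy_nodeBase {φ : ℂ} (hφ : φ ^ 2 = φ + 1) (j : Fin 3) :
    quarticDy φ (nodeBase φ j 0) (nodeBase φ j 1) (nodeBase φ j 2) 1 = 0 := by
  fin_cases j <;> simp [nodeBase, quarticDy] <;> grind

theorem quarticDz_nodeBase {φ : ℂ} (hφ : φ ^ 2 = φ + 1) (j : Fin 3) :
    quarticDz φ (nodeBase φ j 0) (nodeBase φ j 1) (nodeBase φ j 2) 1 = 0 := by
  fin_cases j <;> simp [nodeBase, quarticDz] <;> grind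

theorem quarticDw_nodeBase {φ : ℂ} (hφ : φ ^ 2 = φ + 1) (j : Fin 3) :
    quarticDw φ (nodeBase φ j 0) (nodeBase φ j 1) (nodeBase φ j 2) 1 = 0 := by
  fin_cases j <;> simp [nodeBase, quarticDw] <;> grind

theorem quinticForm_nodeBase {φ : ℂ} (hφ : φ ^ 2 = φ + 1) (j : Fin 3) :
    quinticForm φ (nodeBase φ j 0) (nodeBase φ j 1) (nodeBase φ j 2) 1 = 0 := by
  fin_cases j <;> simp [nodeBase, quinticForm] <;> grind

theorem quinticDy_nodeBase {φ : ℂ} (hφ : φ ^ 2 = φ + 1) (j : Fin 3) :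
    quinticDy φ (nodeBase φ j 0) (nodeBase φ j 1) (nodeBase φ j 2) 1 = 0 := by
  fin_cases j <;> simp [nodeBase, quinticDy] <;> grind

theorem quinticDz_nodeBase {φ : ℂ} (hφ : φ ^ 2 = φ + 1) (j : Fin 3) :
    quinticDz φ (nodeBase φ j 0) (nodeBase φ j 1) (nodeBase φ j 2) 1 = 0 := by
  fin_cases j <;> simp [nodeBase, quinticDz] <;> grind

theorem quinticDw_nodeBase {φ : ℂ} (hφ : φ ^ 2 = φ + 1) (j : Fin 3) :
    quinticDw φ (nodeBase φ j 0) (nodeBase φ j 1) (nodeBase φ j 2) 1 = 0 := by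
  fin_cases j <;> simp [nodeBase, quinticDw] <;> grind

/-- The numbers `p`, `q` in each case are the coefficients of a minor `p + q φ` of the Hessian. -/
theorem isGermOfTypeA_one_nodeBase {φ : ℂ} (hφ : φ ^ 2 = φ + 1) (j : Fin 3) :
    IsGermOfTypeA 1 (fun x => quarticForm φ (x 0) (x 1) (x 2) 1) (nodeBase φ j) := by
  refine quarticForm_germ (quarticForm_nodeBase hφ j) (quarticDx_nodeBase hφ j)
    (quarticDy_nodeBase hφ j) (quarticDz_nodeBase hφ j) ?_ ?_ ?_
  · fin_cases j
    · convert add_mul_golden_ne_zero hφ 12 (-4) (by norm_num) using 1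
      simp [nodeBase]
      grind
    · convert add_mul_golden_ne_zero hφ 28 (-16) (by norm_num) using 1
      simp [nodeBase]
      grind
    · convert add_mul_golden_ne_zero hφ 8 (-4) (by norm_num) using 1
      simp [nodeBase]
      grind
  · fin_cases j
    · convert add_mul_golden_ne_zero hφ 1440 (-880) (by norm_num) using 1
      simp [nodeBase]
      grind
    · convert add_mul_golden_ne_zero hφ 560 (-320) (by norm_num) using 1
      simp [nodeBase]
      grind
    · convert add_mul_golden_ne_zero hφ (-400) 240 (by norm_num) using 1
      simp [nodeBase]
      grind
  · fin_cases j
    · convert add_mul_golden_ne_zero hφ (-68000) 42000 (by norm_num) using 1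
      simp [nodeBase]
      grind
    · convert add_mul_golden_ne_zero hφ (-466000) 288000 (by norm_num) using 1
      simp [nodeBase]
      grind
    · convert add_mul_golden_ne_zero hφ (-35600) 22000 (by norm_num) using 1
      simp [nodeBase]
      grind

/-- The numbers `p`, `q` in each case are the coefficients of one of the three quantities `p + q φ`
that have to be non-zero in `quinticForm_germ`. -/
theorem isGermOfTypeA_two_nodeBase {φ : ℂ} (hφ : φ ^ 2 = φ + 1) (j : Fin 3) :
    IsGermOfTypeA 2 (fun x => quinticForm φ (x 0) (x 1) (x 2) 1) (nodeBase φ j) := by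
  refine quinticForm_germ (quarticForm_nodeBase hφ j) (quarticDx_nodeBase hφ j)
    (quarticDy_nodeBase hφ j) (quarticDz_nodeBase hφ j)
    (quinticForm_nodeBase hφ j) (quinticDy_nodeBase hφ j) (quinticDz_nodeBase hφ j) ?_ ?_ ?_
  · fin_cases j
    · convert add_mul_golden_ne_zero hφ (-1625 / 3) (1000 / 3) (by norm_num) using 1
      simp [nodeBase]
      grind
    · convert add_mul_golden_ne_zero hφ (4250 / 3) (-875) (by norm_num) using 1
      simp [nodeBase]
      grind
    · convert add_mul_golden_ne_zero hφ 175 (-325 / 3) (by norm_num) using 1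
      simp [nodeBase]
      grind
  · fin_cases j
    · convert add_mul_golden_ne_zero hφ (-2125000 / 9) (437500 / 3) (by norm_num) using 1
      simp [nodeBase]
      grind
    · convert add_mul_golden_ne_zero hφ (-14562500 / 9) 1000000 (by norm_num) using 1
      simp [nodeBase]
      grind
    · convert add_mul_golden_ne_zero hφ (-1112500 / 9) (687500 / 9) (by norm_num) using 1
      simp [nodeBase]
      grind
  · fin_cases j
    · convert add_mul_golden_ne_zero hφ 20 (-20 / 3) (by norm_num) using 1
      simp [nodeBase]
      grind
    · convert add_mul_golden_ne_zero hφ (140 / 3) (-80 / 3) (by norm_num) using 1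
      simp [nodeBase]
      grind
    · convert add_mul_golden_ne_zero hφ (40 / 3) (-20 / 3) (by norm_num) using 1
      simp [nodeBase]
      grind

/-- The diagonal automorphism `(η³x, η²y, ηz)` of the chart `w = 1`. -/
noncomputable def chartAut (η : ℂˣ) : (Fin 3 → ℂ) ≃L[ℂ] (Fin 3 → ℂ) :=
  (LinearEquiv.piCongrRight fun i : Fin 3 =>
    LinearEquiv.smulOfUnit (η ^ (3 - (i : ℕ)))).toContinuousLinearEquiv

theorem chartAut_apply (η : ℂˣ) (v : Fin 3 → ℂ) :
    chartAut η v = ![(η : ℂ) ^ 3 * v 0, (η : ℂ) ^ 2 * v 1, (η : ℂ) * v 2] := by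
  funext i
  fin_cases i <;> simp [chartAut, LinearEquiv.smulOfUnit, Units.smul_def]

/-- The quartic is multiplied by `η²` under the automorphism `(η³x, η²y, ηz)`: in the chart `w = 1`
an invariant form of degree four becomes semi-invariant. -/
theorem isGermOfTypeA_one_nodePoint {φ η : ℂ} (hφ : φ ^ 2 = φ + 1) (hη : η ^ 5 = 1) (j : Fin 3) :
    IsGermOfTypeA 1 (fun x => quarticForm φ (x 0) (x 1) (x 2) 1) (nodePoint φ j η) := by
  have h0 : η ≠ 0 := by
    rintro rfl
    norm_num at hη
  have h := (isGermOfTypeA_one_nodeBase hφ j).of_semiinvariant (chartAut (Units.mk0 η h0))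
    (c := η ^ 2) (pow_ne_zero 2 h0) (fun x => by
      simp only [chartAut_apply, quarticForm, Units.val_mk0, Matrix.cons_val]
      grind)
  rwa [chartAut_apply] at h

theorem isGermOfTypeA_two_nodePoint {φ η : ℂ} (hφ : φ ^ 2 = φ + 1) (hη : η ^ 5 = 1) (j : Fin 3) :
    IsGermOfTypeA 2 (fun x => quinticForm φ (x 0) (x 1) (x 2) 1) (nodePoint φ j η) := by
  have h0 : η ≠ 0 := by
    rintro rfl
    norm_num at hη
  have h := (isGermOfTypeA_two_nodeBase hφ j).of_semiinvariant (chartAut (Units.mk0 η h0))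
    (c := 1) one_ne_zero (fun x => by
      simp only [chartAut_apply, quinticForm, Units.val_mk0, Matrix.cons_val]
      grind)
  rwa [chartAut_apply] at h

/-- The germ of the quartic at the fixed point `(0 : 0 : 1 : 0)` in the chart `z = 1`: its quadratic
part is `-(20 - 12 φ) xy + (13 - 8 φ) w²`. -/
theorem isGermOfTypeA_one_fixedPoint {φ : ℂ} (hφ : φ ^ 2 = φ + 1) :
    IsGermOfTypeA 1 (fun x => quarticForm φ (x 0) (x 1) 1 (x 2)) 0 := by
  -- the product `xy` becomes a difference of squares in the coordinates `x + y`, `x - y`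
  let p (i : Fin 3) : (Fin 3 → ℂ) →L[ℂ] ℂ := ContinuousLinearMap.proj i
  have h1 := add_mul_golden_ne_zero hφ 13 (-8) (by norm_num)
  have h2 := add_mul_golden_ne_zero hφ (-20) 12 (by norm_num)
  push_cast at h1 h2
  refine isGermOfTypeA_one_of_quadratic (a := 0)
    (u := fun i x => (![p 2, p 0 + p 1, p 0 - p 1] i) x)
    (A := fun x => 13 - 8 * φ - (12 - 8 * φ) * x 1 * x 2)
    (B := 0)
    (C := fun x => (-(20 - 12 * φ) + ((6 - 4 * φ) * x 2 + x 0 ^ 2)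
      + ((8 - 4 * φ) * x 1 + (4 - 4 * φ) * x 0 * x 2)) / 4)
    (D := 0)
    (E := fun x => (((6 - 4 * φ) * x 2 + x 0 ^ 2)
      - ((8 - 4 * φ) * x 1 + (4 - 4 * φ) * x 0 * x 2)) / 2)
    (G := fun x => ((20 - 12 * φ) + ((6 - 4 * φ) * x 2 + x 0 ^ 2)
      + ((8 - 4 * φ) * x 1 + (4 - 4 * φ) * x 0 * x 2)) / 4)
    (fun i => ContinuousLinearMap.analyticAt _ _) (fun i => map_zero _) ?_ ?_ ?_ ?_ ?_ ?_ ?_ ?_ ?_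
    ?_ ?_
  · simp only [ContinuousLinearMap.fderiv]
    rw [Fintype.linearIndependent_iff]
    intro g hg
    have h (v : Fin 3 → ℂ) := DFunLike.congr_fun hg v
    simp only [Fin.sum_univ_three, p, Matrix.cons_val] at h
    have e0 := h (Pi.single 0 1)
    have e1 := h (Pi.single 1 1)
    have e2 := h (Pi.single 2 1)
    simp at e0 e1 e2
    intro i
    fin_cases i
    · exact e2
    · show g 1 = 0
      linear_combination (e0 + e1) / 2
    · show g 2 = 0
      linear_combination (e0 - e1) / 2
  · fun_prop
  · exact analyticAt_const
  · fun_prop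
  · exact analyticAt_const
  · fun_prop
  · fun_prop
  · simp
    grind
  · simp
    grind
  · simp
    grind
  · intro x
    simp [p, quarticForm]
    ring

/-! ### Evaluating the two equations -/

open MvPolynomial in
theorem eval_quartic (e : ℂ) (v : V4) :
    eval v (quartic e) = quarticForm (1 + e ^ 2 + e ^ 3) (v 0) (v 1) (v 2) (v 3) := by
  simp [quartic, quarticForm]
  ring

open MvPolynomial in
theorem eval_quintic (e : ℂ) (v : V4) :
    eval v (quintic e) = quinticForm (1 + e ^ 2 + e ^ 3) (v 0) (v 1) (v 2) (v 3) := by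
  simp [quintic, quinticForm]
  ring

open MvPolynomial in
theorem pderiv_ofNat (i : Fin 4) (n : ℕ) [n.AtLeastTwo] :
    pderiv i (ofNat(n) : MvPolynomial (Fin 4) ℂ) = 0 :=
  (pderiv i).map_natCast n

open MvPolynomial in
theorem eval_pderiv_quartic (e : ℂ) (v : V4) (i : Fin 4) :
    eval v (pderiv i (quartic e)) = ![quarticDx, quarticDy, quarticDz, quarticDw] i
      (1 + e ^ 2 + e ^ 3) (v 0) (v 1) (v 2) (v 3) := by
  fin_cases i <;> simp [quartic, pderiv_ofNat, Derivation.leibniz_pow, pderiv_X]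
  · simp only [quarticDx]
    ring
  · simp only [quarticDy]
    ring
  · simp only [quarticDz]
    ring
  · simp only [quarticDw]
    ring

open MvPolynomial in
theorem eval_pderiv_quintic (e : ℂ) (v : V4) (i : Fin 4) :
    eval v (pderiv i (quintic e)) =
      ![fun φ x y z w => 5 * quarticForm φ x y z w, quinticDy, quinticDz, quinticDw] i
        (1 + e ^ 2 + e ^ 3) (v 0) (v 1) (v 2) (v 3) := by
  fin_cases i <;> simp [quintic, pderiv_ofNat, Derivation.leibniz_pow, pderiv_X]
  · simp only [quarticForm]
    ring
  · simp only [quinticDy]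
    ring
  · simp only [quinticDz]
    ring
  · simp only [quinticDw]
    ring

/-! ### Homogeneity, field of definition, invariance -/

open MvPolynomial in
theorem isHomogeneous_C_mul_prod (c : ℂ) {i j k l n : ℕ} (hn : i + j + k + l = n) :
    (C c * (x ^ i * y ^ j * z ^ k * w ^ l)).IsHomogeneous n :=
  hn ▸ ((((isHomogeneous_X_pow 0 i).mul (isHomogeneous_X_pow 1 j)).mul
    (isHomogeneous_X_pow 2 k)).mul (isHomogeneous_X_pow 3 l)).C_mul c

open MvPolynomial in
theorem quartic_isHomogeneous (e : ℂ) : (quartic e).IsHomogeneous 4 := by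
  have h (c : ℂ) (i j k l : ℕ) (hn : i + j + k + l = 4) := isHomogeneous_C_mul_prod c hn
  have hq := ((((((h 1 4 0 0 0 rfl).add (h (2 - 4 * (e ^ 3 + e ^ 2)) 2 0 1 1 rfl)).add
    (h (-8 + 12 * (e ^ 3 + e ^ 2)) 1 1 2 0 rfl)).add
    (h (4 - 4 * (e ^ 3 + e ^ 2)) 0 3 1 0 rfl)).add
    (h (-4 + 8 * (e ^ 3 + e ^ 2)) 0 1 0 3 rfl)).add
    (h (5 - 8 * (e ^ 3 + e ^ 2)) 0 0 2 2 rfl)).add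
    (h (-4 * (e ^ 3 + e ^ 2)) 1 2 0 1 rfl)
  convert hq using 1
  simp only [quartic, map_add, map_sub, map_mul, map_neg, map_ofNat, map_one]
  ring

open MvPolynomial in
theorem quintic_isHomogeneous (e : ℂ) : (quintic e).IsHomogeneous 5 := by
  have h (c : ℂ) (i j k l : ℕ) (hn : i + j + k + l = 5) := isHomogeneous_C_mul_prod c hn
  have hq := (((((((((((h 1 5 0 0 0 rfl).add
    (h (10 / 3 - (e ^ 3 + e ^ 2) * (20 / 3)) 3 0 1 1 rfl)).add
    (h (-20 + 30 * (e ^ 3 + e ^ 2)) 2 1 2 0 rfl)).add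
    (h (20 - 20 * (e ^ 3 + e ^ 2)) 1 3 1 0 rfl)).add
    (h (-20 + 40 * (e ^ 3 + e ^ 2)) 1 1 0 3 rfl)).add
    (h (25 - 40 * (e ^ 3 + e ^ 2)) 1 0 2 2 rfl)).add
    (h (-(4 / 3)) 0 5 0 0 rfl)).add
    (h (-(140 / 3) + 70 * (e ^ 3 + e ^ 2)) 0 2 1 2 rfl)).add
    (h (80 - 130 * (e ^ 3 + e ^ 2)) 0 1 3 1 rfl)).add
    (h (-(136 / 3) + (e ^ 3 + e ^ 2) * (220 / 3)) 0 0 5 0 rfl)).add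
    (h (4 - (e ^ 3 + e ^ 2) * (20 / 3)) 0 0 0 5 rfl)).add
    (h (-10 * (e ^ 3 + e ^ 2)) 2 2 0 1 rfl)
  convert hq using 1
  simp only [quintic, map_add, map_sub, map_mul, map_neg, map_ofNat, map_one]
  ring

open MvPolynomial in
theorem coeff_mem_adjoin_of_mem_range {e : ℂ} {F : MvPolynomial (Fin 4) ℂ}
    (hF : F ∈ (map (algebraMap (IntermediateField.adjoin ℚ {e}) ℂ)).range) (m : Fin 4 →₀ ℕ) :
    F.coeff m ∈ IntermediateField.adjoin ℚ {e} := by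
  obtain ⟨G, rfl⟩ := hF
  rw [coeff_map]
  exact (G.coeff m).2

open MvPolynomial in
theorem coeff_quartic_mem (e : ℂ) (m : Fin 4 →₀ ℕ) :
    (quartic e).coeff m ∈ IntermediateField.adjoin ℚ {e} := by
  let t : IntermediateField.adjoin ℚ {e} :=
    ⟨e, IntermediateField.mem_adjoin_simple_self ℚ e⟩
  refine coeff_mem_adjoin_of_mem_range
    ⟨X 0 ^ 4 + 2 * X 0 ^ 2 * X 2 * X 3 - 8 * X 0 * X 1 * X 2 ^ 2 + 4 * X 1 ^ 3 * X 2
      - 4 * X 1 * X 3 ^ 3 + 5 * X 2 ^ 2 * X 3 ^ 2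
      + C (t ^ 3 + t ^ 2) *
        (-4 * X 0 ^ 2 * X 2 * X 3 - 4 * X 0 * X 1 ^ 2 * X 3 + 12 * X 0 * X 1 * X 2 ^ 2
          - 4 * X 1 ^ 3 * X 2 + 8 * X 1 * X 3 ^ 3 - 8 * X 2 ^ 2 * X 3 ^ 2), ?_⟩ m
  have ht : (algebraMap (IntermediateField.adjoin ℚ {e}) ℂ) t = e := rfl
  simp [quartic, ht]

open MvPolynomial in
theorem coeff_quintic_mem (e : ℂ) (m : Fin 4 →₀ ℕ) :
    (quintic e).coeff m ∈ IntermediateField.adjoin ℚ {e} := by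
  let t : IntermediateField.adjoin ℚ {e} :=
    ⟨e, IntermediateField.mem_adjoin_simple_self ℚ e⟩
  refine coeff_mem_adjoin_of_mem_range
    ⟨X 0 ^ 5 + C (10 / 3) * X 0 ^ 3 * X 2 * X 3 - 20 * X 0 ^ 2 * X 1 * X 2 ^ 2
      + 20 * X 0 * X 1 ^ 3 * X 2 - 20 * X 0 * X 1 * X 3 ^ 3 + 25 * X 0 * X 2 ^ 2 * X 3 ^ 2
      - C (4 / 3) * X 1 ^ 5 - C (140 / 3) * X 1 ^ 2 * X 2 * X 3 ^ 2 + 80 * X 1 * X 2 ^ 3 * X 3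
      - C (136 / 3) * X 2 ^ 5 + 4 * X 3 ^ 5
      + C (t ^ 3 + t ^ 2) *
        (-C (20 / 3) * X 0 ^ 3 * X 2 * X 3 - 10 * X 0 ^ 2 * X 1 ^ 2 * X 3
          + 30 * X 0 ^ 2 * X 1 * X 2 ^ 2 - 20 * X 0 * X 1 ^ 3 * X 2 + 40 * X 0 * X 1 * X 3 ^ 3
          - 40 * X 0 * X 2 ^ 2 * X 3 ^ 2 + 70 * X 1 ^ 2 * X 2 * X 3 ^ 2
          - 130 * X 1 * X 2 ^ 3 * X 3 + C (220 / 3) * X 2 ^ 5 - C (20 / 3) * X 3 ^ 5), ?_⟩ m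
  have ht : (algebraMap (IntermediateField.adjoin ℚ {e}) ℂ) t = e := rfl
  simp only [quintic, map_add, map_sub, map_mul, map_pow, map_neg, map_ofNat, map_X, map_C,
    map_div₀, ht]

open MvPolynomial in
theorem isInvariant_quartic {e : ℂˣ} (he : (e : ℂ) ^ 5 = 1) : IsInvariant e (quartic e) := by
  have h : (C (e : ℂ) : MvPolynomial (Fin 4) ℂ) ^ 5 = 1 := by rw [← C_pow, he, C_1]
  simp only [IsInvariant, quartic, map_add, map_sub, map_mul, map_pow, map_neg, map_ofNat, aeval_X,
    aeval_C, algebraMap_eq, Fin.coe_ofNat_eq_mod, Nat.reduceMod]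
  grind

open MvPolynomial in
theorem isInvariant_quintic {e : ℂˣ} (he : (e : ℂ) ^ 5 = 1) : IsInvariant e (quintic e) := by
  have h : (C (e : ℂ) : MvPolynomial (Fin 4) ℂ) ^ 5 = 1 := by rw [← C_pow, he, C_1]
  simp only [IsInvariant, quintic, map_add, map_sub, map_mul, map_pow, map_neg, map_ofNat, aeval_X,
    aeval_C, algebraMap_eq, Fin.coe_ofNat_eq_mod, Nat.reduceMod]
  grind

/-! ### Irreducibility of the quartic -/

open Polynomial in
/-- The section of the quartic by the plane `z = 0`, in the chart `w = 1`, as a polynomial in `x`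
over `ℂ[y]`, is an Eisenstein polynomial at `y`. -/
theorem irreducible_section {a b : ℂ} (hb : b ≠ 0) :
    Irreducible (X ^ 4 + C (C a * X ^ 2) * X + C (C b * X) : ℂ[X][X]) := by
  have hdeg : (X ^ 4 + C (C a * X ^ 2) * X + C (C b * X) : ℂ[X][X]).natDegree = 4 := by
    compute_degree!
  have hmon : (X ^ 4 + C (C a * X ^ 2) * X + C (C b * X) : ℂ[X][X]).Monic := by
    monicity!
  refine irreducible_of_eisenstein_criterion (P := Ideal.span {X})
    ((Ideal.span_singleton_prime X_ne_zero).2 prime_X) ?_ ?_ ?_ ?_ hmon.isPrimitive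
  · rw [hmon.leadingCoeff, Ideal.mem_span_singleton]
    exact fun h => not_isUnit_X (isUnit_of_dvd_one h)
  · intro n hn
    rw [degree_eq_natDegree hmon.ne_zero, hdeg] at hn
    have hn' : n < 4 := by exact_mod_cast hn
    rw [Ideal.mem_span_singleton]
    interval_cases n <;>
      simp [coeff_X, coeff_C, coeff_X_pow, dvd_mul_left, dvd_mul_of_dvd_right, pow_two]
  · rw [degree_eq_natDegree hmon.ne_zero, hdeg]
    norm_num
  · rw [Ideal.span_singleton_pow, Ideal.mem_span_singleton]
    intro h
    have := (X_pow_dvd_iff.1 h) 1 (by norm_num)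
    simp [coeff_C] at this
    exact hb this

open MvPolynomial in
/-- The quartic as a monic polynomial in `x` over the polynomials in `y`, `z`, `w`. -/
theorem finSuccEquiv_quartic (e : ℂ) :
    finSuccEquiv ℂ 3 (quartic e) = Polynomial.X ^ 4
      + Polynomial.C (C (2 - 4 * (e ^ 3 + e ^ 2)) * X 1 * X 2) * Polynomial.X ^ 2
      + Polynomial.C (C (-4 * (e ^ 3 + e ^ 2)) * X 0 ^ 2 * X 2
        + C (-8 + 12 * (e ^ 3 + e ^ 2)) * X 0 * X 1 ^ 2) * Polynomial.X
      + Polynomial.C (C (4 - 4 * (e ^ 3 + e ^ 2)) * X 0 ^ 3 * X 1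
        + C (-4 + 8 * (e ^ 3 + e ^ 2)) * X 0 * X 2 ^ 3
        + C (5 - 8 * (e ^ 3 + e ^ 2)) * X 1 ^ 2 * X 2 ^ 2) := by
  have hx : finSuccEquiv ℂ 3 x = Polynomial.X := finSuccEquiv_X_zero
  have hy : finSuccEquiv ℂ 3 y = Polynomial.C (X 0) := finSuccEquiv_X_succ (j := 0)
  have hz : finSuccEquiv ℂ 3 z = Polynomial.C (X 1) := finSuccEquiv_X_succ (j := 1)
  have hw : finSuccEquiv ℂ 3 w = Polynomial.C (X 2) := finSuccEquiv_X_succ (j := 2)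
  have hC (c : ℂ) : finSuccEquiv ℂ 3 (C c) = Polynomial.C (C c) := by
    simp [finSuccEquiv_apply]
  simp only [quartic, map_add, map_sub, map_mul, map_pow, map_neg, map_ofNat, hx, hy, hz, hw, hC]
  ring

open MvPolynomial in
/-- A monic polynomial in `x` is irreducible if it is so after specializing its coefficients, here
to `z = 0`, `w = 1`. -/
theorem irreducible_quartic {e : ℂ} (hφ : (1 + e ^ 2 + e ^ 3) ^ 2 = (1 + e ^ 2 + e ^ 3) + 1) :
    Irreducible (quartic e) := by
  rw [← MulEquiv.irreducible_iff (finSuccEquiv ℂ 3), finSuccEquiv_quartic]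
  refine Polynomial.Monic.irreducible_of_irreducible_map
    (aeval (R := ℂ) (![Polynomial.X, 0, 1] : Fin 3 → Polynomial ℂ)).toRingHom _ (by monicity!) ?_
  have hb : -4 + 8 * (e ^ 3 + e ^ 2) ≠ 0 := by
    have h := add_mul_golden_ne_zero hφ (-12) 8 (by norm_num)
    push_cast at h
    intro h'
    exact h (by linear_combination h')
  convert irreducible_section (a := -4 * (e ^ 3 + e ^ 2)) hb using 1
  simp only [Polynomial.map_add, Polynomial.map_mul, Polynomial.map_pow, Polynomial.map_X,
    Polynomial.map_C, AlgHom.toRingHom_eq_coe, RingHom.coe_coe, map_add, map_mul, map_pow, aeval_X,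
    aeval_C, Matrix.cons_val, Polynomial.algebraMap_eq, map_zero, map_one]
  ring

/-! ### Points of projective space -/

open MvPolynomial in
theorem eval_smul_of_isHomogeneous {F : MvPolynomial (Fin 4) ℂ} {n : ℕ} (hF : F.IsHomogeneous n)
    (c : ℂ) (v : V4) : eval (c • v) F = c ^ n * eval v F := by
  rw [eval_eq', eval_eq', Finset.mul_sum]
  refine Finset.sum_congr rfl fun d hd => ?_
  have hn : ∑ i, d i = n := by
    rw [← hF (mem_support_iff.1 hd), Finsupp.weight_apply, Finsupp.sum_fintype _ _ (by simp)]
    simp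
  simp only [Pi.smul_apply, smul_eq_mul, mul_pow, Finset.prod_mul_distrib,
    Finset.prod_pow_eq_pow_sum, hn]
  ring

open MvPolynomial in
theorem eval_rep_mk_eq_zero_iff {F : MvPolynomial (Fin 4) ℂ} {n : ℕ} (hF : F.IsHomogeneous n)
    {v : V4} (hv : v ≠ 0) : eval (Projectivization.mk ℂ v hv).rep F = 0 ↔ eval v F = 0 := by
  obtain ⟨a, ha⟩ := Projectivization.exists_smul_eq_mk_rep ℂ v hv
  rw [← ha, Units.smul_def, eval_smul_of_isHomogeneous hF]
  simp

open MvPolynomial in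
theorem mk_mem_surface_iff {F : MvPolynomial (Fin 4) ℂ} {n : ℕ} (hF : F.IsHomogeneous n)
    {v : V4} (hv : v ≠ 0) : Projectivization.mk ℂ v hv ∈ surface F ↔ eval v F = 0 :=
  eval_rep_mk_eq_zero_iff hF hv

open MvPolynomial in
theorem mk_mem_singularLocus_iff {F : MvPolynomial (Fin 4) ℂ} {n : ℕ} (hF : F.IsHomogeneous n)
    {v : V4} (hv : v ≠ 0) : Projectivization.mk ℂ v hv ∈ singularLocus F ↔
      eval v F = 0 ∧ ∀ i, eval v (pderiv i F) = 0 :=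
  and_congr (eval_rep_mk_eq_zero_iff hF hv)
    (forall_congr' fun _ => eval_rep_mk_eq_zero_iff hF.pderiv hv)

open MvPolynomial in
theorem hasTypeA_mk {k : ℕ} {F : MvPolynomial (Fin 4) ℂ} {v : V4} (hv : v ≠ 0) {i : Fin 4}
    (hi : v i ≠ 0) (h : IsGermOfTypeA k (fun u => eval (i.insertNth (1 : ℂ) u : V4) F)
      (fun j => v (i.succAbove j) / v i)) : HasTypeA k F (Projectivization.mk ℂ v hv) := by
  obtain ⟨a, ha⟩ := Projectivization.exists_smul_eq_mk_rep ℂ v hv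
  refine ⟨i, ?_, ?_⟩
  · rw [← ha]
    exact smul_ne_zero a.ne_zero hi
  · convert h using 2 with j
    rw [← ha, Units.smul_def, Pi.smul_apply, Pi.smul_apply, smul_eq_mul, smul_eq_mul,
      mul_div_mul_left _ _ a.ne_zero]

theorem gen_apply (e : ℂˣ) (v : V4) (i : Fin 4) : gen e v i = (e : ℂ) ^ (i : ℕ) * v i := by
  simp [gen, LinearEquiv.smulOfUnit, Units.smul_def]

theorem gen_pow_apply (e : ℂˣ) (k : ℕ) (v : V4) (i : Fin 4) :
    (gen e ^ k) v i = (e : ℂ) ^ (k * (i : ℕ)) * v i := by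
  induction k with
  | zero => simp
  | succ k ih => rw [pow_succ', LinearEquiv.mul_apply, gen_apply, ih]; ring

open MvPolynomial in
theorem eval_gen {e : ℂˣ} {F : MvPolynomial (Fin 4) ℂ} (hF : IsInvariant e F) (v : V4) :
    eval (gen e v) F = eval v F := by
  conv_rhs => rw [← hF]
  rw [← coe_aeval_eq_eval, ← coe_aeval_eq_eval]
  change aeval (gen e v) F = aeval v (aeval _ F)
  rw [← AlgHom.comp_apply, comp_aeval]
  exact DFunLike.congr_fun (congrArg aeval (funext fun i => by simp [gen_apply])) F

theorem image_gen_surface {e : ℂˣ} {F : MvPolynomial (Fin 4) ℂ} {n : ℕ} (hF : F.IsHomogeneous n)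
    (hi : IsInvariant e F) : (fun p : P3 => gen e • p) '' surface F = surface F := by
  have key (p : P3) : gen e • p ∈ surface F ↔ p ∈ surface F := by
    induction p using Projectivization.ind with
    | h v hv =>
      rw [Projectivization.smul_mk, mk_mem_surface_iff hF, mk_mem_surface_iff hF]
      exact Eq.congr_left (eval_gen hi v)
  ext p
  constructor
  · rintro ⟨q, hq, rfl⟩
    exact (key q).2 hq
  · intro hp
    refine ⟨(gen e)⁻¹ • p, ?_, smul_inv_smul _ _⟩
    rwa [← key, smul_inv_smul]

/-! ### Classification of the singular points -/

/-- A singular point of the quartic other than `(0 : 0 : 1 : 0)` lies in the chart `w = 1`, where it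
is one of the points `nodePoint φ j η`. If `y ≠ 0` then `η = x / y`, and `y = 0` occurs only in the
third orbit, for which `η = φ² x² / w²`. -/
theorem eq_nodePoint_of_quarticD_eq_zero {φ x y z w : ℂ} (hφ : φ ^ 2 = φ + 1)
    (hx : quarticDx φ x y z w = 0) (hy : quarticDy φ x y z w = 0)
    (hz : quarticDz φ x y z w = 0) (hw : quarticDw φ x y z w = 0)
    (hne : ¬(x = 0 ∧ y = 0 ∧ w = 0)) :
    w ≠ 0 ∧ ∃ (j : Fin 3) (η : ℂ), η ^ 5 = 1 ∧ x = w * nodePoint φ j η 0 ∧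
      y = w * nodePoint φ j η 1 ∧ z = w * nodePoint φ j η 2 := by
  have h13 := add_mul_golden_ne_zero hφ 1 3 (by norm_num)
  have h11 := add_mul_golden_ne_zero hφ 1 1 (by norm_num)
  have h128 := add_mul_golden_ne_zero hφ 12 (-8) (by norm_num)
  push_cast at h13 h11 h128
  have ry := quartic_relation_y hφ hx hy hz hw
  have rz := quartic_relation_z hφ hx hy hz hw
  have rel_w := quartic_relation_w hφ hx hy hz hw
  -- `x = 0` gives `y⁶ = 0`, and then `∂Q/∂y` reduces to a multiple of `w³`
  have hx0 : x ≠ 0 := by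
    rintro rfl
    have hy0 : y = 0 := pow_eq_zero_iff (n := 6) (by norm_num) |>.1 (by linear_combination ry)
    subst hy0
    have hw0 : (12 + -8 * φ) * w ^ 3 = 0 := by
      unfold quarticDy at hy
      linear_combination -hy
    exact hne ⟨rfl, rfl, by grind⟩
  by_cases hy0 : y = 0
  · subst hy0
    have hzw : z * w = (2 * φ + 1) * x ^ 2 := by
      apply mul_left_cancel₀ hx0
      unfold quarticDx at hx
      linear_combination -(2 * φ + 1) / 4 * hx - 4 * x * z * w * hφ
    have hw0 : w ≠ 0 := by
      rintro rfl
      have h := add_mul_golden_ne_zero hφ 1 2 (by norm_num)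
      push_cast at h
      have h' : (1 + 2 * φ) * x ^ 2 = 0 := by linear_combination -hzw
      simp [h, hx0] at h'
    have hw3 : w ^ 3 = (φ - 1) * x * z ^ 2 := by
      unfold quarticDy at hy
      grind
    have hw5 : w ^ 5 = (5 * φ + 3) * x ^ 5 := by
      grind
    -- `z = η φ w` and `z w = φ³ x²` lead to `η = φ² x² / w²`
    refine ⟨hw0, 2, (φ + 1) * x ^ 2 / w ^ 2, ?_, ?_, ?_, ?_⟩
    · field_simp
      grind
    · simp [nodePoint, nodeBase]
      field_simp
      grind
    · simp [nodePoint, nodeBase]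
    · simp [nodePoint, nodeBase]
      field_simp
      grind
  · have hyx : y ^ 5 = x ^ 5 := mul_left_cancel₀ hy0 (by linear_combination ry)
    have hη : (x / y) ^ 5 = 1 := by
      rw [div_pow, hyx, div_self (pow_ne_zero 5 hx0)]
    have hprod : (x * z - y ^ 2) * (x * z - (2 + 3 * φ) * y ^ 2) = 0 := by
      apply mul_left_cancel₀ hy0
      linear_combination rz
    have hlin : (1 + 3 * φ) * (x ^ 2 * w) = (3 + 4 * φ) * y ^ 3 - (2 + φ) * y * (x * z) := by
      apply mul_left_cancel₀ hy0
      apply mul_left_cancel₀ hx0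
      linear_combination rel_w
    -- the two factors correspond to the first and the second orbit
    rcases mul_eq_zero.1 hprod with h | h
    · have hxw : x ^ 2 * w = y ^ 3 := by
        apply mul_left_cancel₀ h13
        linear_combination hlin - (2 + φ) * y * h
      have hw0 : w ≠ 0 := by
        rintro rfl
        exact pow_ne_zero 3 hy0 (by linear_combination -hxw)
      have hzw : w * x = z * y := by
        apply mul_left_cancel₀ hx0
        linear_combination hxw - y * h
      refine ⟨hw0, 0, x / y, hη, ?_, ?_, ?_⟩
      all_goals
        simp [nodePoint, nodeBase]
        field_simp
        grind
    · have hxw : x ^ 2 * w = -(1 + φ) * y ^ 3 := by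
        apply mul_left_cancel₀ h13
        linear_combination hlin - (2 + φ) * y * h
      have hw0 : w ≠ 0 := by
        rintro rfl
        exact mul_ne_zero h11 (pow_ne_zero 3 hy0) (by linear_combination hxw)
      refine ⟨hw0, 1, x / y, hη, ?_, ?_, ?_⟩
      all_goals
        simp [nodePoint, nodeBase]
        field_simp
        grind

/-- A singular point of the quintic lies in the chart `w = 1`, where it is one of the points
`nodePoint φ j η`. -/
theorem eq_nodePoint_of_quintic {φ x y z w : ℂ} (hφ : φ ^ 2 = φ + 1)
    (h0 : quarticForm φ x y z w = 0) (hy : quinticDy φ x y z w = 0)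
    (hz : quinticDz φ x y z w = 0) (hw : quinticDw φ x y z w = 0)
    (hne : ¬(x = 0 ∧ y = 0 ∧ z = 0 ∧ w = 0)) :
    w ≠ 0 ∧ ∃ (j : Fin 3) (η : ℂ), η ^ 5 = 1 ∧ x = w * nodePoint φ j η 0 ∧
      y = w * nodePoint φ j η 1 ∧ z = w * nodePoint φ j η 2 := by
  have hx0 : x ≠ 0 := by
    rintro rfl
    exact hne ⟨rfl, y_eq_zero_of_quintic hφ h0 hy hz hw, z_eq_zero_of_quintic hφ h0 hy hz hw,
      w_eq_zero_of_quintic hφ h0 hy hz hw⟩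
  refine eq_nodePoint_of_quarticD_eq_zero hφ ?_ ?_ ?_ ?_ fun h => hx0 h.1
  · simpa [hx0] using sq_quarticDx_of_quintic hφ h0 hy hz hw
  · simpa [hx0] using sq_quarticDy_of_quintic hφ h0 hy hz hw
  · simpa [hx0] using sq_quarticDz_of_quintic hφ h0 hy hz hw
  · simpa [hx0] using sq_quarticDw_of_quintic hφ h0 hy hz hw

theorem quarticForm_nodePoint {φ η : ℂ} (hφ : φ ^ 2 = φ + 1) (hη : η ^ 5 = 1) (j : Fin 3) :
    quarticForm φ (nodePoint φ j η 0) (nodePoint φ j η 1) (nodePoint φ j η 2) 1 = 0 := by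
  have h : quarticForm φ (nodePoint φ j η 0) (nodePoint φ j η 1) (nodePoint φ j η 2) 1 =
      η ^ 2 * quarticForm φ (nodeBase φ j 0) (nodeBase φ j 1) (nodeBase φ j 2) 1 := by
    simp only [nodePoint, quarticForm, Matrix.cons_val]
    grind
  rw [h, quarticForm_nodeBase hφ, mul_zero]

theorem quarticDx_nodePoint {φ η : ℂ} (hφ : φ ^ 2 = φ + 1) (hη : η ^ 5 = 1) (j : Fin 3) :
    quarticDx φ (nodePoint φ j η 0) (nodePoint φ j η 1) (nodePoint φ j η 2) 1 = 0 := by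
  have h : quarticDx φ (nodePoint φ j η 0) (nodePoint φ j η 1) (nodePoint φ j η 2) 1 =
      η ^ 4 * quarticDx φ (nodeBase φ j 0) (nodeBase φ j 1) (nodeBase φ j 2) 1 := by
    simp only [nodePoint, quarticDx, Matrix.cons_val]
    grind
  rw [h, quarticDx_nodeBase hφ, mul_zero]

theorem quarticDy_nodePoint {φ η : ℂ} (hφ : φ ^ 2 = φ + 1) (hη : η ^ 5 = 1) (j : Fin 3) :
    quarticDy φ (nodePoint φ j η 0) (nodePoint φ j η 1) (nodePoint φ j η 2) 1 = 0 := by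
  have h : quarticDy φ (nodePoint φ j η 0) (nodePoint φ j η 1) (nodePoint φ j η 2) 1 =
      η ^ 0 * quarticDy φ (nodeBase φ j 0) (nodeBase φ j 1) (nodeBase φ j 2) 1 := by
    simp only [nodePoint, quarticDy, Matrix.cons_val]
    grind
  rw [h, quarticDy_nodeBase hφ, mul_zero]

theorem quarticDz_nodePoint {φ η : ℂ} (hφ : φ ^ 2 = φ + 1) (hη : η ^ 5 = 1) (j : Fin 3) :
    quarticDz φ (nodePoint φ j η 0) (nodePoint φ j η 1) (nodePoint φ j η 2) 1 = 0 := by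
  have h : quarticDz φ (nodePoint φ j η 0) (nodePoint φ j η 1) (nodePoint φ j η 2) 1 =
      η ^ 1 * quarticDz φ (nodeBase φ j 0) (nodeBase φ j 1) (nodeBase φ j 2) 1 := by
    simp only [nodePoint, quarticDz, Matrix.cons_val]
    grind
  rw [h, quarticDz_nodeBase hφ, mul_zero]

theorem quarticDw_nodePoint {φ η : ℂ} (hφ : φ ^ 2 = φ + 1) (hη : η ^ 5 = 1) (j : Fin 3) :
    quarticDw φ (nodePoint φ j η 0) (nodePoint φ j η 1) (nodePoint φ j η 2) 1 = 0 := by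
  have h : quarticDw φ (nodePoint φ j η 0) (nodePoint φ j η 1) (nodePoint φ j η 2) 1 =
      η ^ 2 * quarticDw φ (nodeBase φ j 0) (nodeBase φ j 1) (nodeBase φ j 2) 1 := by
    simp only [nodePoint, quarticDw, Matrix.cons_val]
    grind
  rw [h, quarticDw_nodeBase hφ, mul_zero]

theorem quinticForm_nodePoint {φ η : ℂ} (hφ : φ ^ 2 = φ + 1) (hη : η ^ 5 = 1) (j : Fin 3) :
    quinticForm φ (nodePoint φ j η 0) (nodePoint φ j η 1) (nodePoint φ j η 2) 1 = 0 := by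
  have h : quinticForm φ (nodePoint φ j η 0) (nodePoint φ j η 1) (nodePoint φ j η 2) 1 =
      η ^ 0 * quinticForm φ (nodeBase φ j 0) (nodeBase φ j 1) (nodeBase φ j 2) 1 := by
    simp only [nodePoint, quinticForm, Matrix.cons_val]
    grind
  rw [h, quinticForm_nodeBase hφ, mul_zero]

theorem quinticDy_nodePoint {φ η : ℂ} (hφ : φ ^ 2 = φ + 1) (hη : η ^ 5 = 1) (j : Fin 3) :
    quinticDy φ (nodePoint φ j η 0) (nodePoint φ j η 1) (nodePoint φ j η 2) 1 = 0 := by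
  have h : quinticDy φ (nodePoint φ j η 0) (nodePoint φ j η 1) (nodePoint φ j η 2) 1 =
      η ^ 3 * quinticDy φ (nodeBase φ j 0) (nodeBase φ j 1) (nodeBase φ j 2) 1 := by
    simp only [nodePoint, quinticDy, Matrix.cons_val]
    grind
  rw [h, quinticDy_nodeBase hφ, mul_zero]

theorem quinticDz_nodePoint {φ η : ℂ} (hφ : φ ^ 2 = φ + 1) (hη : η ^ 5 = 1) (j : Fin 3) :
    quinticDz φ (nodePoint φ j η 0) (nodePoint φ j η 1) (nodePoint φ j η 2) 1 = 0 := by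
  have h : quinticDz φ (nodePoint φ j η 0) (nodePoint φ j η 1) (nodePoint φ j η 2) 1 =
      η ^ 4 * quinticDz φ (nodeBase φ j 0) (nodeBase φ j 1) (nodeBase φ j 2) 1 := by
    simp only [nodePoint, quinticDz, Matrix.cons_val]
    grind
  rw [h, quinticDz_nodeBase hφ, mul_zero]

theorem quinticDw_nodePoint {φ η : ℂ} (hφ : φ ^ 2 = φ + 1) (hη : η ^ 5 = 1) (j : Fin 3) :
    quinticDw φ (nodePoint φ j η 0) (nodePoint φ j η 1) (nodePoint φ j η 2) 1 = 0 := by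
  have h : quinticDw φ (nodePoint φ j η 0) (nodePoint φ j η 1) (nodePoint φ j η 2) 1 =
      η ^ 0 * quinticDw φ (nodeBase φ j 0) (nodeBase φ j 1) (nodeBase φ j 2) 1 := by
    simp only [nodePoint, quinticDw, Matrix.cons_val]
    grind
  rw [h, quinticDw_nodeBase hφ, mul_zero]

/-! ### The fifteen nodes in projective space -/

/-- Homogeneous coordinates of the node `nodePoint φ j η`. -/
def nodeVec (φ : ℂ) (j : Fin 3) (η : ℂ) : V4 :=
  ![nodePoint φ j η 0, nodePoint φ j η 1, nodePoint φ j η 2, 1]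

theorem nodeVec_ne_zero (φ : ℂ) (j : Fin 3) (η : ℂ) : nodeVec φ j η ≠ 0 :=
  fun h => one_ne_zero (congrFun h 3)

/-- The fifteen points of `ℙ³` given by the points `nodePoint φ j η` of the chart `w = 1`. -/
noncomputable def node (φ : ℂ) (p : Fin 3 × rootsOfUnity 5 ℂ) : P3 :=
  Projectivization.mk ℂ (nodeVec φ p.1 (p.2 : ℂˣ)) (nodeVec_ne_zero _ _ _)

theorem rootsOfUnity_pow_five (η : rootsOfUnity 5 ℂ) : ((η : ℂˣ) : ℂ) ^ 5 = 1 := by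
  have h := η.2
  rw [mem_rootsOfUnity'] at h
  exact h

theorem mk_mem_range_node {φ η : ℂ} {v : V4} (hv : v ≠ 0) {j : Fin 3} (hη : η ^ 5 = 1)
    (h0 : v 0 = v 3 * nodePoint φ j η 0) (h1 : v 1 = v 3 * nodePoint φ j η 1)
    (h2 : v 2 = v 3 * nodePoint φ j η 2) : Projectivization.mk ℂ v hv ∈ Set.range (node φ) := by
  refine ⟨(j, rootsOfUnity.mkOfPowEq η hη), ?_⟩
  rw [node, Projectivization.mk_eq_mk_iff']
  have h3 : v 3 ≠ 0 := by
    intro h3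
    apply hv
    funext i
    fin_cases i <;> simp [h0, h1, h2, h3]
  refine ⟨(v 3)⁻¹, ?_⟩
  funext i
  fin_cases i <;> simp [nodeVec, h0, h1, h2, h3]

/-- The coordinate `z` of a representative; its fifth power is constant on the orbit and
distinguishes the three orbits. -/
theorem nodeBase_two_pow_five {φ : ℂ} (hφ : φ ^ 2 = φ + 1) (j : Fin 3) :
    nodeBase φ j 2 ^ 5 = ![1, -(34 + 55 * φ), 3 + 5 * φ] j := by
  fin_cases j <;> simp [nodeBase] <;> grind

theorem nodeBase_two_ne_zero {φ : ℂ} (hφ : φ ^ 2 = φ + 1) (j : Fin 3) : nodeBase φ j 2 ≠ 0 := by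
  have h1 := add_mul_golden_ne_zero hφ (-1) (-1) (by norm_num)
  have h2 := add_mul_golden_ne_zero hφ 0 1 (by norm_num)
  push_cast at h1 h2
  fin_cases j <;> simp [nodeBase] <;> grind

theorem node_injective {φ : ℂ} (hφ : φ ^ 2 = φ + 1) : Function.Injective (node φ) := by
  rintro ⟨j, η⟩ ⟨j', η'⟩ h
  rw [node, node, Projectivization.mk_eq_mk_iff'] at h
  obtain ⟨a, ha⟩ := h
  have h3 := congrFun ha 3
  have h2 := congrFun ha 2
  simp [nodeVec, nodePoint] at h3 h2
  rw [h3, one_mul] at h2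
  have hj : j = j' := by
    have h5 := congrArg (· ^ 5) h2
    simp only [mul_pow, rootsOfUnity_pow_five, one_mul, nodeBase_two_pow_five hφ] at h5
    have e1 := add_mul_golden_ne_zero hφ 35 55 (by norm_num)
    have e2 := add_mul_golden_ne_zero hφ 2 5 (by norm_num)
    have e3 := add_mul_golden_ne_zero hφ 37 60 (by norm_num)
    push_cast at e1 e2 e3
    fin_cases j <;> fin_cases j' <;> first | rfl | (exfalso; simp at h5; grind)
  subst hj
  have h : ((η' : ℂˣ) : ℂ) = (η : ℂˣ) := mul_right_cancel₀ (nodeBase_two_ne_zero hφ j) h2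
  rw [Prod.mk.injEq]
  exact ⟨rfl, Subtype.ext (Units.ext h.symm)⟩

theorem ncard_range_node {φ : ℂ} (hφ : φ ^ 2 = φ + 1) :
    (Set.range (node φ)).ncard = 15 := by
  rw [Set.ncard_range_of_injective (node_injective hφ), Nat.card_prod, Nat.card_fin,
    Complex.card_rootsOfUnity]

theorem fixedPoint_notMem_range_node (φ : ℂ) : fixedPoint ∉ Set.range (node φ) := by
  rintro ⟨p, hp⟩
  rw [node, fixedPoint, Projectivization.mk_eq_mk_iff'] at hp
  obtain ⟨a, ha⟩ := hp
  have := congrFun ha 3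
  simp [nodeVec] at this

/-! ### The singular loci and the types of their points -/

theorem golden_of_isPrimitiveRoot {e : ℂ} (he : IsPrimitiveRoot e 5) :
    (1 + e ^ 2 + e ^ 3) ^ 2 = (1 + e ^ 2 + e ^ 3) + 1 := by
  have h := he.geom_sum_eq_zero (by norm_num)
  simp only [Finset.sum_range_succ, Finset.sum_range_zero] at h
  linear_combination (e ^ 2 + e - 1) * h

theorem singularLocus_quartic {e : ℂ} (he : IsPrimitiveRoot e 5) :
    singularLocus (quartic e) = insert fixedPoint (Set.range (node (1 + e ^ 2 + e ^ 3))) := by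
  have hφ := golden_of_isPrimitiveRoot he
  ext p
  induction p using Projectivization.ind with
  | h v hv =>
    constructor
    · intro h
      rw [mk_mem_singularLocus_iff (quartic_isHomogeneous e)] at h
      simp only [eval_pderiv_quartic] at h
      by_cases hne : v 0 = 0 ∧ v 1 = 0 ∧ v 3 = 0
      · left
        rw [fixedPoint, Projectivization.mk_eq_mk_iff']
        refine ⟨v 2, ?_⟩
        funext i
        fin_cases i <;> simp [hne]
      · right
        obtain ⟨-, j, η, hη, h0, h1, h2⟩ := eq_nodePoint_of_quarticD_eq_zero hφ (h.2 0) (h.2 1)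
          (h.2 2) (h.2 3) hne
        exact mk_mem_range_node hv hη h0 h1 h2
    · rintro (h | ⟨⟨j, η⟩, h⟩)
      · rw [h, fixedPoint, mk_mem_singularLocus_iff (quartic_isHomogeneous e)]
        refine ⟨by simp [eval_quartic, quarticForm], fun i => ?_⟩
        rw [eval_pderiv_quartic]
        fin_cases i <;> simp [quarticDx, quarticDy, quarticDz, quarticDw]
      · have hη := rootsOfUnity_pow_five η
        rw [← h, node, mk_mem_singularLocus_iff (quartic_isHomogeneous e)]
        refine ⟨(eval_quartic _ _).trans (quarticForm_nodePoint hφ hη j), fun i => ?_⟩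
        rw [eval_pderiv_quartic]
        fin_cases i
        · exact quarticDx_nodePoint hφ hη j
        · exact quarticDy_nodePoint hφ hη j
        · exact quarticDz_nodePoint hφ hη j
        · exact quarticDw_nodePoint hφ hη j

theorem singularLocus_quintic {e : ℂ} (he : IsPrimitiveRoot e 5) :
    singularLocus (quintic e) = Set.range (node (1 + e ^ 2 + e ^ 3)) := by
  have hφ := golden_of_isPrimitiveRoot he
  ext p
  induction p using Projectivization.ind with
  | h v hv =>
    constructor
    · intro h
      rw [mk_mem_singularLocus_iff (quintic_isHomogeneous e)] at h
      simp only [eval_pderiv_quintic] at h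
      obtain ⟨-, j, η, hη, h0, h1, h2⟩ := eq_nodePoint_of_quintic hφ
        (by simpa using h.2 0) (h.2 1) (h.2 2) (h.2 3) (fun hne => hv (by
          funext i
          fin_cases i <;> simp [hne]))
      exact mk_mem_range_node hv hη h0 h1 h2
    · rintro ⟨⟨j, η⟩, h⟩
      have hη := rootsOfUnity_pow_five η
      rw [← h, node, mk_mem_singularLocus_iff (quintic_isHomogeneous e)]
      refine ⟨(eval_quintic _ _).trans (quinticForm_nodePoint hφ hη j), fun i => ?_⟩
      rw [eval_pderiv_quintic]
      fin_cases i
      · exact mul_eq_zero_of_right _ (quarticForm_nodePoint hφ hη j)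
      · exact quinticDy_nodePoint hφ hη j
      · exact quinticDz_nodePoint hφ hη j
      · exact quinticDw_nodePoint hφ hη j

theorem isNode_node {e : ℂ} (he : IsPrimitiveRoot e 5) (p : Fin 3 × rootsOfUnity 5 ℂ) :
    IsNode (quartic e) (node (1 + e ^ 2 + e ^ 3) p) := by
  refine hasTypeA_mk _ (i := 3) one_ne_zero ?_
  convert isGermOfTypeA_one_nodePoint (golden_of_isPrimitiveRoot he) (rootsOfUnity_pow_five p.2) p.1
    using 1
  · funext u
    exact eval_quartic _ _
  · funext j
    fin_cases j <;> exact div_one _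

theorem isCusp_node {e : ℂ} (he : IsPrimitiveRoot e 5) (p : Fin 3 × rootsOfUnity 5 ℂ) :
    IsCusp (quintic e) (node (1 + e ^ 2 + e ^ 3) p) := by
  refine hasTypeA_mk _ (i := 3) one_ne_zero ?_
  convert isGermOfTypeA_two_nodePoint (golden_of_isPrimitiveRoot he) (rootsOfUnity_pow_five p.2) p.1
    using 1
  · funext u
    exact eval_quintic _ _
  · funext j
    fin_cases j <;> exact div_one _

theorem isNode_fixedPoint {e : ℂ} (he : IsPrimitiveRoot e 5) :
    IsNode (quartic e) fixedPoint := by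
  refine hasTypeA_mk _ (i := 2) one_ne_zero ?_
  convert isGermOfTypeA_one_fixedPoint (golden_of_isPrimitiveRoot he) using 1
  · funext u
    exact eval_quartic _ _
  · funext j
    fin_cases j <;> exact div_one _

/-! ### The action of the cyclic group -/

theorem gen_smul_fixedPoint (e : ℂˣ) : gen e • fixedPoint = fixedPoint := by
  rw [fixedPoint, Projectivization.smul_mk, Projectivization.mk_eq_mk_iff']
  refine ⟨(e : ℂ) ^ 2, ?_⟩
  funext i
  rw [LinearEquiv.smul_def, gen_apply]
  fin_cases i <;> simp

/-- Since the coordinates `z` and `w` of a node are both non-zero, a node that is fixed would force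
`e² = e³`. -/
theorem gen_smul_node_ne {e : ℂˣ} (he : (e : ℂ) ≠ 1) {φ : ℂ} (hφ : φ ^ 2 = φ + 1)
    (p : Fin 3 × rootsOfUnity 5 ℂ) : gen e • node φ p ≠ node φ p := by
  intro h
  rw [node, Projectivization.smul_mk, Projectivization.mk_eq_mk_iff'] at h
  obtain ⟨a, ha⟩ := h
  have h3 := congrFun ha 3
  have h2 := congrFun ha 2
  rw [LinearEquiv.smul_def, gen_apply] at h2 h3
  simp [nodeVec, nodePoint] at h2 h3
  rcases h2 with h2 | h2
  · exact he (mul_left_cancel₀ (pow_ne_zero 2 e.ne_zero) (by linear_combination h2 - h3))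
  · exact nodeBase_two_ne_zero hφ _ h2

theorem orderOf_gen {e : ℂˣ} (he : IsPrimitiveRoot (e : ℂ) 5) : orderOf (gen e) = 5 := by
  have : Fact (Nat.Prime 5) := ⟨by norm_num⟩
  refine orderOf_eq_prime ?_ ?_
  · ext v i
    rw [gen_pow_apply, pow_mul, he.pow_eq_one, one_pow, one_mul]
    rfl
  · intro h
    have := congrFun (DFunLike.congr_fun h (fun _ => 1)) 1
    rw [gen_apply] at this
    exact he.ne_one (by norm_num) (by simpa using this)

/-- A fixed point of a non-trivial power of the automorphism has only one non-zero coordinate,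
because the eigenvalues are distinct; and the coefficients of `x⁵`, `y⁵`, `z⁵`, `w⁵` in the quintic
do not vanish. -/
theorem smul_ne_of_mem_surface_quintic {e : ℂˣ} (he : IsPrimitiveRoot (e : ℂ) 5)
    {g : V4 ≃ₗ[ℂ] V4} (hg : g ∈ Subgroup.zpowers (gen e)) (hg1 : g ≠ 1) {p : P3}
    (hp : p ∈ surface (quintic e)) : g • p ≠ p := by
  have hφ := golden_of_isPrimitiveRoot he
  have hfin : IsOfFinOrder (gen e) := by
    rw [← orderOf_pos_iff, orderOf_gen he]
    norm_num
  obtain ⟨k, rfl⟩ := (hfin.mem_powers_iff_mem_zpowers).2 hg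
  have hk : ¬ 5 ∣ k := by
    rintro ⟨m, rfl⟩
    apply hg1
    change gen e ^ (5 * m) = 1
    rw [pow_mul, ← orderOf_gen he, pow_orderOf_eq_one, one_pow]
  have hε : IsPrimitiveRoot ((e : ℂ) ^ k) 5 :=
    he.pow_of_coprime k (((Nat.Prime.coprime_iff_not_dvd (by norm_num)).2 hk).symm)
  induction p using Projectivization.ind with
  | h v hv =>
    intro h
    change (gen e ^ k) • _ = _ at h
    rw [Projectivization.smul_mk, Projectivization.mk_eq_mk_iff'] at h
    obtain ⟨a, ha⟩ := h
    have hev (i : Fin 4) : a * v i = ((e : ℂ) ^ k) ^ (i : ℕ) * v i := by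
      have := congrFun ha i
      rw [LinearEquiv.smul_def, gen_pow_apply, pow_mul] at this
      exact this
    obtain ⟨i, hi⟩ := Function.ne_iff.1 hv
    have hai : a = ((e : ℂ) ^ k) ^ (i : ℕ) := mul_right_cancel₀ hi (hev i)
    have hz (j : Fin 4) (hj : j ≠ i) : v j = 0 := by
      by_contra hj0
      have := hai.symm.trans (mul_right_cancel₀ hj0 (hev j))
      exact hj (Fin.ext (hε.pow_inj (by omega) (by omega) this).symm)
    rw [mk_mem_surface_iff (quintic_isHomogeneous e), eval_quintic] at hp
    have h1 := add_mul_golden_ne_zero hφ (-356 / 3) (220 / 3) (by norm_num)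
    have h2 := add_mul_golden_ne_zero hφ (32 / 3) (-20 / 3) (by norm_num)
    push_cast at h1 h2
    unfold quinticForm at hp
    fin_cases i
    · simp [hz] at hp hi
      exact hi hp
    · simp [hz] at hp hi
      exact hi hp
    · rw [hz 0 (by decide), hz 1 (by decide), hz 3 (by decide)] at hp
      exact mul_ne_zero h1 (pow_ne_zero 5 (show v 2 ≠ 0 from hi)) (by linear_combination hp)
    · rw [hz 0 (by decide), hz 1 (by decide), hz 2 (by decide)] at hp
      exact mul_ne_zero h2 (pow_ne_zero 5 (show v 3 ≠ 0 from hi)) (by linear_combination hp)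

end RitoQuintic

theorem mainTheorem1 (e : ℂˣ) (he : IsPrimitiveRoot (e : ℂ) 5) :
    -- the group acting is cyclic of order five
    Nat.card (Subgroup.zpowers (RitoQuintic.gen e)) = 5 ∧
    -- `S` is a quintic defined over `ℚ(e)`
    (RitoQuintic.quintic e).IsHomogeneous 5 ∧ RitoQuintic.quintic e ≠ 0 ∧
    (∀ m, (RitoQuintic.quintic e).coeff m ∈ IntermediateField.adjoin ℚ {(e : ℂ)}) ∧
    -- `S` is invariant
    RitoQuintic.IsInvariant e (RitoQuintic.quintic e) ∧
    (fun p : RitoQuintic.P3 => RitoQuintic.gen e • p) ''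
      RitoQuintic.surface (RitoQuintic.quintic e) = RitoQuintic.surface (RitoQuintic.quintic e) ∧
    -- the action on `S` is free
    (∀ g ∈ Subgroup.zpowers (RitoQuintic.gen e), g ≠ 1 →
      ∀ p ∈ RitoQuintic.surface (RitoQuintic.quintic e), g • p ≠ p) ∧
    -- the singularities of `S` are exactly 15 ordinary cusps
    (RitoQuintic.singularLocus (RitoQuintic.quintic e)).ncard = 15 ∧
    (∀ p ∈ RitoQuintic.singularLocus (RitoQuintic.quintic e),
      RitoQuintic.IsCusp (RitoQuintic.quintic e) p) ∧
    -- `Q` is an invariant Kummer quartic defined over `ℚ(e)`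
    RitoQuintic.IsKummerQuartic (RitoQuintic.quartic e) ∧
    (∀ m, (RitoQuintic.quartic e).coeff m ∈ IntermediateField.adjoin ℚ {(e : ℂ)}) ∧
    RitoQuintic.IsInvariant e (RitoQuintic.quartic e) ∧
    (fun p : RitoQuintic.P3 => RitoQuintic.gen e • p) ''
      RitoQuintic.surface (RitoQuintic.quartic e) = RitoQuintic.surface (RitoQuintic.quartic e) ∧
    -- the only fixed node of `Q` is `(0 : 0 : 1 : 0)`, the others are the cusps of `S`
    {p ∈ RitoQuintic.singularLocus (RitoQuintic.quartic e) | RitoQuintic.gen e • p = p} =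
      {RitoQuintic.fixedPoint} ∧
    {p ∈ RitoQuintic.singularLocus (RitoQuintic.quartic e) | RitoQuintic.gen e • p ≠ p} =
      RitoQuintic.singularLocus (RitoQuintic.quintic e) := by
  have hφ := RitoQuintic.golden_of_isPrimitiveRoot he
  have hQ := RitoQuintic.singularLocus_quartic he
  have hS := RitoQuintic.singularLocus_quintic he
  have hcard := RitoQuintic.ncard_range_node hφ
  have hfix := RitoQuintic.gen_smul_fixedPoint e
  have hmove := RitoQuintic.gen_smul_node_ne (he.ne_one (by norm_num)) hφ
  have hiQ := RitoQuintic.isInvariant_quartic he.pow_eq_one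
  have hiS := RitoQuintic.isInvariant_quintic he.pow_eq_one
  have hhQ := RitoQuintic.quartic_isHomogeneous e
  have hhS := RitoQuintic.quintic_isHomogeneous e
  refine ⟨?_, hhS, ?_, RitoQuintic.coeff_quintic_mem e, hiS,
    RitoQuintic.image_gen_surface hhS hiS,
    fun g hg hg1 p hp => RitoQuintic.smul_ne_of_mem_surface_quintic he hg hg1 hp,
    hS ▸ hcard, ?_, ⟨hhQ, RitoQuintic.irreducible_quartic hφ, ?_, ?_⟩,
    RitoQuintic.coeff_quartic_mem e, hiQ, RitoQuintic.image_gen_surface hhQ hiQ, ?_, ?_⟩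
  · rw [Nat.card_zpowers, RitoQuintic.orderOf_gen he]
  · intro h
    have h1 := RitoQuintic.eval_quintic e ![1, 0, 0, 0]
    rw [h] at h1
    simp [RitoQuintic.quinticForm] at h1
  · rw [hS]
    rintro _ ⟨p, rfl⟩
    exact RitoQuintic.isCusp_node he p
  · rw [hQ, Set.ncard_insert_of_notMem (RitoQuintic.fixedPoint_notMem_range_node _)
      (Set.finite_of_ncard_pos (by rw [hcard]; norm_num)), hcard]
  · rw [hQ]
    rintro _ (rfl | ⟨p, rfl⟩)
    · exact RitoQuintic.isNode_fixedPoint he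
    · exact RitoQuintic.isNode_node he p
  · ext q
    rw [hQ]
    constructor
    · rintro ⟨rfl | ⟨p, rfl⟩, h⟩
      · rfl
      · exact absurd h (hmove p)
    · rintro rfl
      exact ⟨Set.mem_insert _ _, hfix⟩
  · ext q
    rw [hQ, hS]
    constructor
    · rintro ⟨rfl | hq, h⟩
      · exact absurd hfix h
      · exact hq
    · rintro ⟨p, rfl⟩
      exact ⟨Set.mem_insert_of_mem _ ⟨p, rfl⟩, hmove p⟩
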